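/- Let $n\ge 2$, let $|\cdot|$ be the supremum norm on $\mathbb R^n$ and $d$ the induced distance, let $B=\{I\in\mathbb R^n : |I|<1\}$ and $\mathbb T^n=\mathbb R^n/\mathbb Z^n$. Let \[ H(\theta,I)=h(I)+\varepsilon f(\theta,I),\qquad (\theta,I)\in\mathbb T^n\times B,\ \varepsilon>0, \] where $h$ and $f$ are of class $C^3$, $|h|_{C^2(B)}\le 1$ and $|f|_{C^3(\mathbb T^n\times B)}\le 1$; here $|\cdot|_{C^k}$ is the supremum of the absolute values of all partial derivatives of order at most $k$. Assume: (A.1) There is $I^*\in B$ such that $\omega:=\partial_I h(I^*)$ is non-zero and resonant, i.e. $k\cdot\omega=0$ for some $k\in\mathbb Z^n\setminus\{0\}$. Let $\Lambda$ be the real subspace of $\mathbb R^n$ spanned by $\{k\in\mathbb Z^n : k\cdot\omega=0\}$, let $\Lambda^\perp$ be its Euclidean orthogonal complement, and let \[ f_\omega^*(\theta)=\lim_{t\to+\infty}\frac1t\int_0^t f(\theta+s\omega,I^*)\,ds . \] (A.2) The function $f_\omega^*$ is non-constant: there is $\theta^*\in\mathbb T^n$ with $\lambda:=|\partial_\theta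 f^*_\omega(\theta^*)|>0$. Let $Q_\omega=\min\{|k| : k\in\Lambda^\perp\cap\mathbb Z^n\setminus\{0\}\}$, and define \[ \Psi(Q)=\max\{|k\cdot\omega|^{-1} : k\in\Lambda^\perp\cap\mathbb Z^n,\ 0<|k|\le Q\}\quad (Q\ge Q_\omega), \] \[ \Delta(x)=\sup\{Q\ge Q_\omega : Q\,\Psi(Q)\le x\}\quad (x\ge Q_\omega\Psi(Q_\omega)). \] Then there are positive constants $\kappa$ and $C$ depending only on $n,|\omega|,\Lambda$; positive constants $c$ and $\delta$ depending only on $\lambda,\Lambda$; and a positive constant $\mu_0$ depending only on $n,|\omega|,\Lambda,\lambda$ and on the distance $1-|I^*|$ from $I^*$ to the boundary of $B$ (hence only on $n,|\omega|,\Lambda,\lambda$ when $I^*=0$), such that the following holds. If $\kappa/\sqrt\varepsilon\ge Q_\omega\Psi(Q_\omega)$ and \[ 0<\mu(\sqrt\varepsilon):=\Delta\big(\kappa\sqrt\varepsilon^{\,-1}\big)^{-1}\le\mu_0, \] then, with $\tau:=\delta/\sqrt\varepsilon$, the Hamiltonian system \[ \dot\theta=\partial_I H(\theta,I),\qquad \dot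 I=-\partial_\theta H(\theta,I) \] has a solution $(\theta(t),I(t))\in\mathbb T^n\times B$, $0\le t\le\tau$, such that \[ |I(\tau)-I(0)|\ge c\sqrt\varepsilon,\qquad d(I(0),I^*)\le C\sqrt\varepsilon\,\mu(\sqrt\varepsilon), \] \[ d(I(t)-I(0),\Lambda)\le C\sqrt\varepsilon\,\mu(\sqrt\varepsilon)\quad\text{for } 0\le t\le\tau . \] -/

import Mathlib

open Set Filter Topology MeasureTheory
open scoped ENNReal

namespace MicroDiffusion

/-- The action domain: the open unit ball of `ℝⁿ` for the supremum norm. -/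
def actionBall (n : ℕ) : Set (Fin n → ℝ) := Metric.ball 0 1

/-- The (lifted) phase space `ℝⁿ × B`, covering `𝕋ⁿ × B` with `𝕋ⁿ = ℝⁿ / ℤⁿ`. -/
def phaseSpace (n : ℕ) : Set ((Fin n → ℝ) × (Fin n → ℝ)) := univ ×ˢ actionBall n

/-- An integer vector, seen in `ℝⁿ`. -/
def intVec {n : ℕ} (k : Fin n → ℤ) : Fin n → ℝ := fun i => (k i : ℝ)

/-- `f` is a function on `𝕋ⁿ × B`: it is `ℤⁿ`-periodic in the angles. -/
def AnglePeriodic {n : ℕ} (f : (Fin n → ℝ) × (Fin n → ℝ) → ℝ) : Prop :=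
  ∀ (k : Fin n → ℤ) (θ I : Fin n → ℝ), I ∈ actionBall n → f (θ + intVec k, I) = f (θ, I)

/-- The canonical basis of `ℝⁿ`. -/
def stdVec (n : ℕ) : Fin n → (Fin n → ℝ) := fun i => Pi.single i 1

/-- The canonical basis of `ℝⁿ × ℝⁿ`. -/
def stdVecProd (n : ℕ) : Fin n ⊕ Fin n → (Fin n → ℝ) × (Fin n → ℝ) :=
  Sum.elim (fun i => (Pi.single i 1, 0)) (fun i => (0, Pi.single i 1))

/-- The `C^k`-norm of `u` on the open set `S`: the supremum over `S` of the absolute values of all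
partial derivatives of `u` of order at most `k` in the directions of the basis `b`. -/
noncomputable def cNorm {ι E : Type*} [NormedAddCommGroup E] [NormedSpace ℝ E]
    (b : ι → E) (k : ℕ) (S : Set E) (u : E → ℝ) : ℝ≥0∞ :=
  ⨆ x ∈ S, ⨆ m : ℕ, ⨆ _ : m ≤ k, ⨆ v : Fin m → ι,
    ‖iteratedFDeriv ℝ m u x (fun j => b (v j))‖ₑ

/-- The vector of first partial derivatives of a function on `ℝⁿ`. -/
noncomputable def grad {n : ℕ} (u : (Fin n → ℝ) → ℝ) (x : Fin n → ℝ) : Fin n → ℝ :=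
  fun i => fderiv ℝ u x (Pi.single i 1)

/-- The Hamiltonian `H(θ, I) = h(I) + ε f(θ, I)`. -/
def hamiltonian {n : ℕ} (h : (Fin n → ℝ) → ℝ) (f : (Fin n → ℝ) × (Fin n → ℝ) → ℝ) (ε : ℝ) :
    (Fin n → ℝ) × (Fin n → ℝ) → ℝ :=
  fun p => h p.2 + ε * f p

/-- `t ↦ (θ(t), I(t))`, `0 ≤ t ≤ τ`, is a solution in `𝕋ⁿ × B` (with lifted angles) of
`θ' = ∂_I H(θ, I)`, `I' = - ∂_θ H(θ, I)`. -/
def IsSolution {n : ℕ} (H : (Fin n → ℝ) × (Fin n → ℝ) → ℝ) (τ : ℝ)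
    (θ I : ℝ → (Fin n → ℝ)) : Prop :=
  ∀ t ∈ Icc 0 τ, I t ∈ actionBall n ∧
    HasDerivWithinAt θ (grad (fun J => H (θ t, J)) (I t)) (Icc 0 τ) t ∧
    HasDerivWithinAt I (-grad (fun φ => H (φ, I t)) (θ t)) (Icc 0 τ) t

/-- `ω` is resonant but non-zero. -/
def IsResonantNonzero {n : ℕ} (ω : Fin n → ℝ) : Prop :=
  ω ≠ 0 ∧ ∃ k : Fin n → ℤ, k ≠ 0 ∧ intVec k ⬝ᵥ ω = 0

/-- The real subspace spanned by the integer vectors `k` with `k · ω = 0`. -/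
def resonantSubspace {n : ℕ} (ω : Fin n → ℝ) : Submodule ℝ (Fin n → ℝ) :=
  Submodule.span ℝ {x | ∃ k : Fin n → ℤ, intVec k ⬝ᵥ ω = 0 ∧ x = intVec k}

/-- The average `f_ω(θ, I) = lim_{t → ∞} (1/t) ∫₀ᵗ f(θ + s ω, I) ds`. -/
noncomputable def average {n : ℕ} (ω : Fin n → ℝ) (f : (Fin n → ℝ) × (Fin n → ℝ) → ℝ)
    (θ I : Fin n → ℝ) : ℝ :=
  limUnder atTop (fun t : ℝ => (1 / t) * ∫ s in (0 : ℝ)..t, f (θ + s • ω, I))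

/-- The non-zero integer vectors orthogonal to the resonant subspace of `ω`. -/
def transverseInt {n : ℕ} (ω : Fin n → ℝ) : Set (Fin n → ℤ) :=
  {k | k ≠ 0 ∧ ∀ v ∈ resonantSubspace ω, intVec k ⬝ᵥ v = 0}

/-- `Q_ω`: the smallest `Q` for which the maximum defining `Ψ(Q)` is over a non-empty set. -/
noncomputable def Qmin {n : ℕ} (ω : Fin n → ℝ) : ℝ :=
  sInf ((fun k => ‖intVec k‖) '' transverseInt ω)

/-- `Ψ(Q)`: the maximum of `|k · ω|⁻¹` over the non-zero integer `k` orthogonal to the resonant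
subspace with `|k| ≤ Q` (a finite set, non-empty for `Q ≥ Q_ω`). -/
noncomputable def Psi {n : ℕ} (ω : Fin n → ℝ) (Q : ℝ) : ℝ :=
  sSup ((fun k => |intVec k ⬝ᵥ ω|⁻¹) '' {k ∈ transverseInt ω | ‖intVec k‖ ≤ Q})

/-- `Δ(x) = sup {Q ≥ Q_ω | Q Ψ(Q) ≤ x}`, meaningful for `x ≥ Q_ω Ψ(Q_ω)`; for smaller `x` the set
is empty and the value is `0`. -/
noncomputable def Delta {n : ℕ} (ω : Fin n → ℝ) (x : ℝ) : ℝ :=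
  sSup {Q | Qmin ω ≤ Q ∧ Q * Psi ω Q ≤ x}

end MicroDiffusion

/-!
Write `r = √ε`. The orbit issued from `(θ*, I*)` has the required properties. Over the time `δ / r`
its actions move by at most `δ r`, so its angles stay within `O(δ²)` of the linear flow
`θ* + t ω`, and the actions obey `I' = -ε ∂_θ f(θ, I*)` up to `O(ε r)` (`exists_trajectory`).
Everything reduces to time integrals of functions on the torus along paths that nearly follow `ω`.

These integrals are controlled without solving a homological equation in Fourier series, so that no
regularity is lost to small divisors. Take an integrable kernel `ρ` on the line with finite first
moment and Fourier transform supported in `(-1, 1)` (`BandLimitedKernel`), and let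
`M_w F(x) = ∫ ρ(s) F(x + s w) ds`.
* The operator `M_{T ω}` replaces a time integral by a nearby one: the error is `O(T)`, by a shift of
  the time variable under the integral (`norm_integral_smear_sub_le`).
* The composition `S` of the operators `M_{e_i / N}` moves a Lipschitz function by `O(1 / N)`.
* `M_{T ω} ∘ S` kills the characters `exp(2πi k·θ)` with `|k| ≥ N`, and those with `k·ω ≠ 0` as soon
  as `T |k·ω| ≥ 1` for `|k| < N`. By density of trigonometric polynomials, its values are invariant
  under the translations orthogonal to `Λ` (`resonantPart_add`), and it kills derivatives in these
  directions (`resonantPart_deriv`).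

So time integrals over `[0, t]` are those of an invariant function up to `O(T + t / N)`. Here
`N` is of order `Q` and `T` of order `Ψ(Q)`, for some `Q ≥ 1 / (2 μ)` with `Q Ψ(Q) ≤ 1 / r`
(`exists_cutoff`). That `Ψ`, which involves only integer vectors in `Λ^⊥`, controls all small divisors
`k·ω` comes from the rationality of the orthogonal projection onto `Λ^⊥` (`IntegralProjection`).
For derivatives in directions of `Λ^⊥` the resonant part vanishes, and the actions move by
`O(ε T + r / N) = O(r μ)` in these directions (`transverse_upper_bound`). For the other partial
derivatives the time average converges to the corresponding derivative of the averaged function, and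
the drift is at least `δ r lam / 2` for `δ` small with respect to `lam` and `μ` small
(`drift_lower_bound`).
-/

/-! ### Band-limited kernels and averaging along a direction -/

namespace MicroDiffusion

/-- An integrable kernel on `ℝ` of total mass `1`, with finite first moment, whose Fourier
transform vanishes outside `(-1, 1)`. -/
structure BandLimitedKernel where
  /-- The kernel as a function on the line. -/
  ker : ℝ → ℝ
  integrable_ker : Integrable ker
  integrable_moment : Integrable fun s => |s| * |ker s|
  integral_ker : ∫ s, ker s = 1
  integral_exp_eq_zero : ∀ ξ : ℝ, 1 ≤ |ξ| →
    ∫ s, (ker s : ℂ) * Complex.exp (2 * Real.pi * Complex.I * (s * ξ : ℝ)) = 0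

open FourierTransform SchwartzMap in
/-- The real part of the Fourier transform of a smooth bump function is such a kernel. -/
theorem nonempty_bandLimitedKernel : Nonempty BandLimitedKernel := by
  let φ : ContDiffBump (0 : ℝ) := ⟨1 / 4, 1 / 2, by norm_num, by norm_num⟩
  have hcs : HasCompactSupport (fun x => (φ x : ℂ)) :=
    φ.hasCompactSupport.comp_left (g := fun x : ℝ => (x : ℂ)) (by simp)
  have hsm : ContDiff ℝ (⊤ : ℕ∞) (fun x => (φ x : ℂ)) :=
    Complex.ofRealCLM.contDiff.comp φ.contDiff
  let u : 𝓢(ℝ, ℂ) := hcs.toSchwartzMap hsm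
  let v : 𝓢(ℝ, ℂ) := 𝓕 u
  have hu : ∀ x, u x = (φ x : ℂ) := fun x => rfl
  have hinv : ∀ ξ : ℝ, ∫ s, v s * Complex.exp (2 * Real.pi * Complex.I * (s * ξ : ℝ)) = φ ξ := by
    intro ξ
    have h1 : (𝓕⁻ v) ξ = u ξ := by
      rw [FourierPair.fourierInv_fourier_eq u]
    rw [SchwartzMap.fourierInv_coe, Real.fourierInv_eq', hu] at h1
    rw [← h1]
    refine integral_congr_ae (Eventually.of_forall fun s => ?_)
    simp only [smul_eq_mul, RCLike.inner_apply, conj_trivial]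
    rw [mul_comm]
    congr 2
    push_cast
    ring
  have hvi : Integrable (fun s => v s) := v.integrable
  have hexp : ∀ ξ s : ℝ, ‖Complex.exp (2 * Real.pi * Complex.I * (s * ξ : ℝ))‖ = 1 := by
    intro ξ s
    rw [show 2 * (Real.pi : ℂ) * Complex.I * (s * ξ : ℝ) = ((2 * Real.pi * (s * ξ) : ℝ) : ℂ) * Complex.I
      by push_cast; ring, Complex.norm_exp_ofReal_mul_I]
  have hint : ∀ ξ : ℝ, Integrable
      (fun s => v s * Complex.exp (2 * Real.pi * Complex.I * (s * ξ : ℝ))) := by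
    intro ξ
    refine hvi.mul_bdd (c := 1) (by fun_prop) (Eventually.of_forall fun s => (hexp ξ s).le)
  have hφ0 : ∀ ξ : ℝ, 1 ≤ |ξ| → φ ξ = 0 := by
    intro ξ hξ
    apply φ.zero_of_le_dist
    rw [Real.dist_eq, sub_zero]
    exact le_trans (by norm_num [φ]) hξ
  refine ⟨⟨fun s => (v s).re, hvi.re, ?_, ?_, ?_⟩⟩
  · have := v.integrable_pow_mul volume 1
    refine this.mono' (by fun_prop) (Eventually.of_forall fun s => ?_)
    simp only [norm_mul, Real.norm_eq_abs, abs_abs, pow_one]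
    exact mul_le_mul_of_nonneg_left (Complex.abs_re_le_norm _) (abs_nonneg _)
  · have h0 := hinv 0
    simp only [mul_zero, Complex.ofReal_zero, Complex.exp_zero, mul_one] at h0
    have h1 : φ 0 = 1 := φ.one_of_mem_closedBall (by simp [φ.rIn_pos.le])
    rw [h1] at h0
    have h2 := integral_re (𝕜 := ℂ) hvi
    simp only [RCLike.re_to_complex] at h2
    rw [h2, h0]
    simp
  · intro ξ hξ
    have e1 := hinv ξ
    have e2 := hinv (-ξ)
    rw [hφ0 ξ hξ] at e1
    rw [hφ0 (-ξ) (by rwa [abs_neg])] at e2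
    -- `2 Re v = v + conj v`, and conjugation turns the frequency `ξ` into `-ξ`.
    have e3 : ∫ s, (starRingEnd ℂ)
        (v s * Complex.exp (2 * Real.pi * Complex.I * (s * (-ξ) : ℝ))) = 0 := by
      rw [integral_conj, e2]
      simp
    have hi3 : Integrable (fun s => (starRingEnd ℂ)
        (v s * Complex.exp (2 * Real.pi * Complex.I * (s * (-ξ) : ℝ)))) :=
      (Complex.conjCLE.toContinuousLinearMap).integrable_comp (hint (-ξ))
    have e4 := integral_add (hint ξ) hi3
    rw [e1, e3] at e4
    have e5 : ∀ s : ℝ, ((v s).re : ℂ) * Complex.exp (2 * Real.pi * Complex.I * (s * ξ : ℝ)) =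
        (1 / 2 : ℂ) * (v s * Complex.exp (2 * Real.pi * Complex.I * (s * ξ : ℝ)) +
        (starRingEnd ℂ) (v s * Complex.exp (2 * Real.pi * Complex.I * (s * (-ξ) : ℝ)))) := by
      intro s
      rw [map_mul, ← Complex.exp_conj, Complex.re_eq_add_conj]
      simp only [map_mul, Complex.conj_I, Complex.conj_ofReal, map_ofNat]
      rw [show 2 * (Real.pi : ℂ) * -Complex.I * ((s * -ξ : ℝ) : ℂ) =
        2 * Real.pi * Complex.I * (s * ξ : ℝ) by push_cast; ring]
      ring
    simp_rw [e5]
    rw [integral_const_mul, e4]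
    simp

namespace BandLimitedKernel

variable {E : Type*} [NormedAddCommGroup E] [NormedSpace ℝ E] (K : BandLimitedKernel)

/-- The `L¹` norm of the kernel. -/
noncomputable def mass : ℝ := ∫ s, |K.ker s|

/-- The absolute first moment of the kernel. -/
noncomputable def moment : ℝ := ∫ s, |s| * |K.ker s|

theorem mass_nonneg : 0 ≤ K.mass := integral_nonneg fun _ => abs_nonneg _

theorem moment_nonneg : 0 ≤ K.moment :=
  integral_nonneg fun _ => mul_nonneg (abs_nonneg _) (abs_nonneg _)

theorem integrable_ofReal : Integrable fun s => (K.ker s : ℂ) := K.integrable_ker.ofReal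

theorem integrable_mul {g : ℝ → ℂ} (hg : Continuous g) {B : ℝ} (hB : ∀ s, ‖g s‖ ≤ B) :
    Integrable fun s => (K.ker s : ℂ) * g s :=
  K.integrable_ofReal.mul_bdd hg.aestronglyMeasurable (Eventually.of_forall hB)

theorem norm_integral_mul_le {g : ℝ → ℂ} {B : ℝ} (hB : ∀ s, ‖g s‖ ≤ B) :
    ‖∫ s, (K.ker s : ℂ) * g s‖ ≤ K.mass * B := by
  rw [mass, ← integral_mul_const]
  refine norm_integral_le_of_norm_le (K.integrable_ker.abs.mul_const B)
    (Eventually.of_forall fun s => ?_)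
  rw [norm_mul, Complex.norm_real, Real.norm_eq_abs]
  exact mul_le_mul_of_nonneg_left (hB s) (abs_nonneg _)

theorem norm_integral_mul_le_moment {g : ℝ → ℂ} {B : ℝ} (hB : ∀ s, ‖g s‖ ≤ |s| * B) :
    ‖∫ s, (K.ker s : ℂ) * g s‖ ≤ K.moment * B := by
  rw [moment, ← integral_mul_const]
  refine norm_integral_le_of_norm_le (K.integrable_moment.mul_const B)
    (Eventually.of_forall fun s => ?_)
  rw [norm_mul, Complex.norm_real, Real.norm_eq_abs]
  calc |K.ker s| * ‖g s‖ ≤ |K.ker s| * (|s| * B) :=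
        mul_le_mul_of_nonneg_left (hB s) (abs_nonneg _)
    _ = |s| * |K.ker s| * B := by ring

/-- The weighted average `x ↦ ∫ ρ(s) F(x + s w) ds` of a bounded continuous function along the
direction `w`, as an operator. -/
noncomputable def smear (w : E) :
    (BoundedContinuousFunction E ℂ) →L[ℂ] (BoundedContinuousFunction E ℂ) :=
  LinearMap.mkContinuous
    { toFun := fun F => BoundedContinuousFunction.ofNormedAddCommGroup
        (fun x => ∫ s, (K.ker s : ℂ) * F (x + s • w))
        (continuous_of_dominated (bound := fun s => |K.ker s| * ‖F‖)
          (fun x => (K.integrable_mul (by fun_prop)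
            (fun s => F.norm_coe_le_norm _)).aestronglyMeasurable)
          (fun x => Eventually.of_forall fun s => by
            rw [norm_mul, Complex.norm_real, Real.norm_eq_abs]
            exact mul_le_mul_of_nonneg_left (F.norm_coe_le_norm _) (abs_nonneg _))
          (K.integrable_ker.abs.mul_const _)
          (Eventually.of_forall fun s => by fun_prop))
        (K.mass * ‖F‖) (fun x => K.norm_integral_mul_le fun s => F.norm_coe_le_norm _)
      map_add' := fun F G => by
        ext x
        simp only [BoundedContinuousFunction.coe_ofNormedAddCommGroup,
          BoundedContinuousFunction.add_apply, mul_add]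
        exact integral_add
          (K.integrable_mul (by fun_prop) fun s => F.norm_coe_le_norm _)
          (K.integrable_mul (by fun_prop) fun s => G.norm_coe_le_norm _)
      map_smul' := fun c F => by
        ext x
        simp only [BoundedContinuousFunction.coe_ofNormedAddCommGroup,
          BoundedContinuousFunction.smul_apply, smul_eq_mul, RingHom.id_apply]
        rw [← integral_const_mul]
        congr 1
        ext s
        ring }
    K.mass
    (fun F => (BoundedContinuousFunction.norm_le (mul_nonneg K.mass_nonneg (norm_nonneg _))).2
      fun x => K.norm_integral_mul_le fun s => F.norm_coe_le_norm _)

theorem smear_apply (w : E) (F : BoundedContinuousFunction E ℂ) (x : E) :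
    K.smear w F x = ∫ s, (K.ker s : ℂ) * F (x + s • w) := rfl

theorem norm_smear_le (w : E) (F : BoundedContinuousFunction E ℂ) :
    ‖K.smear w F‖ ≤ K.mass * ‖F‖ :=
  (BoundedContinuousFunction.norm_le (mul_nonneg K.mass_nonneg (norm_nonneg _))).2
    fun _ => K.norm_integral_mul_le fun _ => F.norm_coe_le_norm _

theorem smear_apply_sub (w : E) (F : BoundedContinuousFunction E ℂ) (x : E) :
    K.smear w F x - F x = ∫ s, (K.ker s : ℂ) * (F (x + s • w) - F x) := by
  simp_rw [mul_sub]
  rw [integral_sub (K.integrable_mul (by fun_prop) fun s => F.norm_coe_le_norm _)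
    (K.integrable_ofReal.mul_const _), integral_mul_const, integral_complex_ofReal,
    K.integral_ker, smear_apply]
  simp

theorem norm_smear_sub_le (w : E) (F : BoundedContinuousFunction E ℂ) {κ : ℝ}
    (hF : ∀ x y, ‖F x - F y‖ ≤ κ * ‖x - y‖) :
    ‖K.smear w F - F‖ ≤ K.moment * (κ * ‖w‖) := by
  have hκ : 0 ≤ κ * ‖w‖ := by
    simpa using (norm_nonneg _).trans (hF w 0)
  refine (BoundedContinuousFunction.norm_le (mul_nonneg K.moment_nonneg hκ)).2 fun x => ?_
  rw [BoundedContinuousFunction.sub_apply, smear_apply_sub]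
  refine K.norm_integral_mul_le_moment fun s => (hF _ _).trans_eq ?_
  rw [add_sub_cancel_left, norm_smul, Real.norm_eq_abs]
  ring

end BandLimitedKernel

end MicroDiffusion

/-! ### Characters of the torus and repeated averaging -/

namespace MicroDiffusion

/-- The character `θ ↦ exp(2πi k·θ)` of `ℝⁿ / ℤⁿ`, as a bounded continuous function on `ℝⁿ`. -/
noncomputable def character {n : ℕ} (k : Fin n → ℤ) :
    BoundedContinuousFunction (Fin n → ℝ) ℂ :=
  BoundedContinuousFunction.ofNormedAddCommGroup
    (fun θ => Complex.exp (2 * Real.pi * Complex.I * (intVec k ⬝ᵥ θ : ℝ)))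
    (by unfold dotProduct; fun_prop) 1 (fun θ => by
      rw [show 2 * (Real.pi : ℂ) * Complex.I * (intVec k ⬝ᵥ θ : ℝ) =
        ((2 * Real.pi * (intVec k ⬝ᵥ θ) : ℝ) : ℂ) * Complex.I by push_cast; ring,
        Complex.norm_exp_ofReal_mul_I])

theorem character_apply {n : ℕ} (k : Fin n → ℤ) (θ : Fin n → ℝ) :
    character k θ = Complex.exp (2 * Real.pi * Complex.I * (intVec k ⬝ᵥ θ : ℝ)) := rfl

theorem character_add {n : ℕ} (k : Fin n → ℤ) (θ φ : Fin n → ℝ) :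
    character k (θ + φ) = character k θ * character k φ := by
  rw [character_apply, character_apply, character_apply, ← Complex.exp_add, dotProduct_add]
  push_cast
  ring_nf

/-- A continuous function on the torus is a uniform limit of trigonometric polynomials. -/
theorem exists_trigPoly_near {n : ℕ} (F : BoundedContinuousFunction (Fin n → ℝ) ℂ)
    (hF : ∀ (k : Fin n → ℤ) (θ : Fin n → ℝ), F (θ + intVec k) = F θ) {ε : ℝ} (hε : 0 < ε) :
    ∃ p ∈ Submodule.span ℂ (range (character (n := n))), ‖F - p‖ ≤ ε := by
  let π : (Fin n → ℝ) → UnitAddTorus (Fin n) := fun θ i => (θ i : UnitAddCircle)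
  have hπ : IsOpenQuotientMap π :=
    IsOpenQuotientMap.piMap (f := fun _ : Fin n => ((↑) : ℝ → UnitAddCircle))
      fun _ => QuotientAddGroup.isOpenQuotientMap_mk
  let G : UnitAddTorus (Fin n) → ℂ := fun x => F (Function.surjInv hπ.surjective x)
  have hG : ∀ θ, G (π θ) = F θ := by
    intro θ
    have h1 : π (Function.surjInv hπ.surjective (π θ)) = π θ := Function.surjInv_eq _ _
    have h2 : ∀ i, ∃ m : ℤ, (Function.surjInv hπ.surjective (π θ)) i = θ i + m := by
      intro i
      have h3 := congrFun h1 i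
      obtain ⟨m, hm⟩ := AddSubgroup.mem_zmultiples_iff.1 (QuotientAddGroup.eq_iff_sub_mem.1 h3)
      refine ⟨m, ?_⟩
      rw [zsmul_one] at hm
      linarith
    choose m hm using h2
    have h4 : Function.surjInv hπ.surjective (π θ) = θ + intVec m := funext hm
    simp only [G]
    rw [h4, hF]
  have hGc : Continuous G := by
    rw [hπ.isQuotientMap.continuous_iff]
    have : G ∘ π = F := funext hG
    rw [this]
    exact F.continuous
  have hmem : (⟨G, hGc⟩ : C(UnitAddTorus (Fin n), ℂ)) ∈
      (Submodule.span ℂ (range <| UnitAddTorus.mFourier (d := Fin n))).topologicalClosure := by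
    rw [UnitAddTorus.span_mFourier_closure_eq_top]
    trivial
  obtain ⟨q, hq, hqd⟩ := Metric.mem_closure_iff.1 hmem ε hε
  -- Pull back a trigonometric polynomial along the projection `ℝⁿ → ℝⁿ / ℤⁿ`.
  have hpull : ∀ q ∈ Submodule.span ℂ (range <| UnitAddTorus.mFourier (d := Fin n)),
      ∃ p ∈ Submodule.span ℂ (range (character (n := n))), ∀ θ, p θ = q (π θ) := by
    intro q hq
    induction hq using Submodule.span_induction with
    | mem q hq =>
      obtain ⟨k, rfl⟩ := hq
      refine ⟨character k, Submodule.subset_span ⟨k, rfl⟩, fun θ => ?_⟩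
      simp only [UnitAddTorus.mFourier, ContinuousMap.coe_mk, π, fourier_coe_apply]
      rw [← Complex.exp_sum, character_apply]
      congr 1
      simp only [dotProduct, intVec]
      push_cast
      rw [Finset.mul_sum]
      refine Finset.sum_congr rfl fun i _ => ?_
      simp only [div_one]
      ring
    | zero => exact ⟨0, Submodule.zero_mem _, fun θ => rfl⟩
    | add q₁ q₂ _ _ h₁ h₂ =>
      obtain ⟨p₁, hp₁, e₁⟩ := h₁
      obtain ⟨p₂, hp₂, e₂⟩ := h₂
      exact ⟨p₁ + p₂, Submodule.add_mem _ hp₁ hp₂, fun θ => by simp [e₁, e₂]⟩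
    | smul c q _ h =>
      obtain ⟨p, hp, e⟩ := h
      exact ⟨c • p, Submodule.smul_mem _ _ hp, fun θ => by simp [e]⟩
  obtain ⟨p, hp, hpq⟩ := hpull q hq
  refine ⟨p, hp, (BoundedContinuousFunction.norm_le hε.le).2 fun θ => ?_⟩
  rw [BoundedContinuousFunction.sub_apply, hpq, ← hG, ← dist_eq_norm]
  exact (ContinuousMap.dist_apply_le_dist (f := ⟨G, hGc⟩) (g := q) (π θ)).trans hqd.le

namespace BandLimitedKernel

variable {E : Type*} [NormedAddCommGroup E] [NormedSpace ℝ E] (K : BandLimitedKernel)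

theorem smear_character {n : ℕ} (w : Fin n → ℝ) (k : Fin n → ℤ) :
    ∃ a : ℂ, K.smear w (character k) = a • character k ∧ (1 ≤ |intVec k ⬝ᵥ w| → a = 0) := by
  refine ⟨∫ s, (K.ker s : ℂ) * Complex.exp (2 * Real.pi * Complex.I *
    (s * (intVec k ⬝ᵥ w) : ℝ)), ?_, K.integral_exp_eq_zero _⟩
  ext θ
  rw [smear_apply, BoundedContinuousFunction.smul_apply, smul_eq_mul, ← integral_mul_const]
  congr 1
  ext s
  rw [character_add, character_apply k (s • w), dotProduct_smul, smul_eq_mul]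
  ring

/-- Successive averaging along a list of directions. -/
noncomputable def smearList (l : List E) :
    (BoundedContinuousFunction E ℂ) →L[ℂ] (BoundedContinuousFunction E ℂ) :=
  l.foldr (fun w A => (K.smear w).comp A) (ContinuousLinearMap.id _ _)

theorem smearList_cons (w : E) (l : List E) (F : BoundedContinuousFunction E ℂ) :
    K.smearList (w :: l) F = K.smear w (K.smearList l F) := rfl

theorem norm_smearList_le (l : List E) (F : BoundedContinuousFunction E ℂ) :
    ‖K.smearList l F‖ ≤ K.mass ^ l.length * ‖F‖ := by
  induction l with
  | nil => simp [smearList]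
  | cons w l ih =>
    rw [smearList_cons, List.length_cons, pow_succ']
    calc _ ≤ K.mass * ‖K.smearList l F‖ := K.norm_smear_le _ _
      _ ≤ K.mass * (K.mass ^ l.length * ‖F‖) := mul_le_mul_of_nonneg_left ih K.mass_nonneg
      _ = _ := by ring

/-- The constant in the error estimate for successive averaging along `m` directions. -/
noncomputable def smearConst : ℕ → ℝ
  | 0 => 0
  | m + 1 => K.mass * smearConst m + K.moment

theorem smearConst_nonneg (m : ℕ) : 0 ≤ K.smearConst m := by
  induction m with
  | zero => exact le_rfl
  | succ m ih => exact add_nonneg (mul_nonneg K.mass_nonneg ih) K.moment_nonneg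

theorem norm_smearList_sub_le (l : List E) {r : ℝ} (hl : ∀ w ∈ l, ‖w‖ ≤ r)
    (F : BoundedContinuousFunction E ℂ) {κ : ℝ} (hκ : 0 ≤ κ)
    (hF : ∀ x y, ‖F x - F y‖ ≤ κ * ‖x - y‖) :
    ‖K.smearList l F - F‖ ≤ K.smearConst l.length * (κ * r) := by
  induction l with
  | nil => simp [smearList, smearConst]
  | cons w l ih =>
    have hl' := ih fun w hw => hl w (List.mem_cons_of_mem _ hw)
    have hw := hl w List.mem_cons_self
    have h1 : K.smearList (w :: l) F - F =
        K.smear w (K.smearList l F - F) + (K.smear w F - F) := by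
      rw [smearList_cons, map_sub]
      abel
    rw [h1, List.length_cons, smearConst]
    calc _ ≤ ‖K.smear w (K.smearList l F - F)‖ + ‖K.smear w F - F‖ := norm_add_le _ _
      _ ≤ K.mass * (K.smearConst l.length * (κ * r)) + K.moment * (κ * r) := by
        refine add_le_add ((K.norm_smear_le _ _).trans
          (mul_le_mul_of_nonneg_left hl' K.mass_nonneg)) ((K.norm_smear_sub_le w F hF).trans ?_)
        have := K.moment_nonneg
        gcongr
      _ = _ := by ring

theorem smearList_character {n : ℕ} (l : List (Fin n → ℝ)) (k : Fin n → ℤ) :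
    ∃ a : ℂ, K.smearList l (character k) = a • character k ∧
      ∀ w ∈ l, 1 ≤ |intVec k ⬝ᵥ w| → a = 0 := by
  induction l with
  | nil => exact ⟨1, by simp [smearList], by simp⟩
  | cons w l ih =>
    obtain ⟨a, ha, hal⟩ := ih
    obtain ⟨b, hb, hbw⟩ := K.smear_character w k
    refine ⟨a * b, by rw [smearList_cons, ha, map_smul, hb, smul_smul], ?_⟩
    intro u hu h1
    rcases List.mem_cons.1 hu with rfl | hu
    · rw [hbw h1, mul_zero]
    · rw [hal u hu h1, zero_mul]

theorem smearList_comp_add (l : List E) (F G : BoundedContinuousFunction E ℂ) (v : E)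
    (hG : ∀ x, G x = F (x + v)) (x : E) : K.smearList l G x = K.smearList l F (x + v) := by
  induction l generalizing x with
  | nil => exact hG x
  | cons w l ih =>
    rw [smearList_cons, smearList_cons, smear_apply, smear_apply]
    simp_rw [ih]
    congr 1
    ext s
    rw [add_right_comm]

end BandLimitedKernel

end MicroDiffusion

/-! ### The resonant part of a function on the torus -/

namespace MicroDiffusion

namespace BandLimitedKernel

variable (K : BandLimitedKernel)

/-- Averaging over a time window of length of order `T` along a path that follows the direction `ω`
up to a slow drift changes the time integral of `F` only by boundary terms and by the effect of the
drift over the window. -/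
theorem norm_integral_smear_sub_le {E : Type*} [NormedAddCommGroup E] [NormedSpace ℝ E]
    (F : BoundedContinuousFunction E ℂ) {κ : ℝ} (hκ : 0 ≤ κ)
    (hF : ∀ x y, ‖F x - F y‖ ≤ κ * ‖x - y‖) (ω : E) {T : ℝ} (hT : 0 ≤ T) {ζ : ℝ → E} {η : ℝ}
    (hζc : Continuous ζ) (hζ : ∀ s u, ‖ζ s - ζ u‖ ≤ η * |s - u|) {t : ℝ} (ht : 0 ≤ t) :
    ‖∫ s in (0 : ℝ)..t, (K.smear (T • ω) F (s • ω + ζ s) - F (s • ω + ζ s))‖ ≤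
      K.moment * (T * (2 * ‖F‖ + κ * η * t)) := by
  have h1 : ∫ s in (0 : ℝ)..t, (K.smear (T • ω) F (s • ω + ζ s) - F (s • ω + ζ s)) =
      ∫ u, (K.ker u : ℂ) *
        ∫ s in (0 : ℝ)..t, (F (s • ω + ζ s + u • T • ω) - F (s • ω + ζ s)) := by
    simp_rw [smear_apply_sub, ← intervalIntegral.integral_const_mul]
    rw [← intervalIntegral_integral_swap]
    rw [uIoc_of_le ht]
    have h2 : Integrable (fun p : ℝ × ℝ => ((K.ker p.2 : ℂ) * (1 : ℂ)))
        ((volume.restrict (Ioc 0 t)).prod volume) :=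
      (K.integrable_ofReal.mul_const 1).comp_snd _
    simp only [mul_one] at h2
    refine h2.mul_bdd (c := ‖F‖ + ‖F‖) ?_ (Eventually.of_forall fun p => ?_)
    · exact Continuous.aestronglyMeasurable (by fun_prop)
    · exact (norm_sub_le _ _).trans
        (add_le_add (F.norm_coe_le_norm _) (F.norm_coe_le_norm _))
  rw [h1]
  refine K.norm_integral_mul_le_moment fun u => ?_
  set a : ℝ := u * T with ha
  have hη : 0 ≤ η := by
    have := (norm_nonneg _).trans (hζ 1 0)
    simpa using this
  have hc : Continuous fun s => F (s • ω + ζ s) := by fun_prop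
  have hc' : Continuous fun s => F ((s + a) • ω + ζ (s + a)) := by fun_prop
  have hc'' : Continuous fun s => F (s • ω + ζ s + u • T • ω) := by fun_prop
  have h3 : ∫ s in (0 : ℝ)..t, (F (s • ω + ζ s + u • T • ω) - F (s • ω + ζ s)) =
      (∫ s in (0 : ℝ)..t, (F (s • ω + ζ s + u • T • ω) - F ((s + a) • ω + ζ (s + a)))) +
      ((∫ s in t..(t + a), F (s • ω + ζ s)) - ∫ s in (0 : ℝ)..a, F (s • ω + ζ s)) := by
    rw [intervalIntegral.integral_sub (hc''.intervalIntegrable _ _) (hc.intervalIntegrable _ _),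
      intervalIntegral.integral_sub (hc''.intervalIntegrable _ _) (hc'.intervalIntegrable _ _),
      intervalIntegral.integral_comp_add_right (fun s => F (s • ω + ζ s)), zero_add]
    have e1 := intervalIntegral.integral_add_adjacent_intervals
      (hc.intervalIntegrable 0 t) (hc.intervalIntegrable (μ := volume) t (t + a))
    have e2 := intervalIntegral.integral_add_adjacent_intervals
      (hc.intervalIntegrable 0 a) (hc.intervalIntegrable (μ := volume) a (t + a))
    linear_combination e2 - e1
  rw [h3]
  have b1 : ‖∫ s in (0 : ℝ)..t, (F (s • ω + ζ s + u • T • ω) - F ((s + a) • ω + ζ (s + a)))‖ ≤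
      (κ * (η * |a|)) * |t - 0| := by
    refine intervalIntegral.norm_integral_le_of_norm_le_const fun s _ => (hF _ _).trans ?_
    have : s • ω + ζ s + u • T • ω - ((s + a) • ω + ζ (s + a)) = ζ s - ζ (s + a) := by
      rw [ha, add_smul, mul_smul]
      abel
    rw [this]
    refine mul_le_mul_of_nonneg_left ((hζ _ _).trans_eq ?_) hκ
    rw [show s - (s + a) = -a by ring, abs_neg]
  have b2 : ‖∫ s in t..(t + a), F (s • ω + ζ s)‖ ≤ ‖F‖ * |t + a - t| :=
    intervalIntegral.norm_integral_le_of_norm_le_const fun s _ => F.norm_coe_le_norm _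
  have b3 : ‖∫ s in (0 : ℝ)..a, F (s • ω + ζ s)‖ ≤ ‖F‖ * |a - 0| :=
    intervalIntegral.norm_integral_le_of_norm_le_const fun s _ => F.norm_coe_le_norm _
  have haT : |a| = |u| * T := by rw [ha, abs_mul, abs_of_nonneg hT]
  rw [sub_zero, abs_of_nonneg ht] at b1
  rw [add_sub_cancel_left] at b2
  rw [sub_zero] at b3
  calc _ ≤ κ * (η * |a|) * t + (‖F‖ * |a| + ‖F‖ * |a|) :=
        (norm_add_le _ _).trans (add_le_add b1 ((norm_sub_le _ _).trans (add_le_add b2 b3)))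
    _ = |u| * (T * (2 * ‖F‖ + κ * η * t)) := by rw [haT]; ring

end BandLimitedKernel

/-- `1 / T` bounds from below the non-zero values of `|k · ω|` over the integer vectors `k` of norm
less than `N`. -/
def SmallDivisorBound {n : ℕ} (ω : Fin n → ℝ) (N T : ℝ) : Prop :=
  ∀ k : Fin n → ℤ, ‖intVec k‖ < N → intVec k ⬝ᵥ ω ≠ 0 → 1 ≤ T * |intVec k ⬝ᵥ ω|

namespace BandLimitedKernel

variable (K : BandLimitedKernel) {n : ℕ}

/-- The averaging operator over the time scale `T` in the direction `ω` composed with a smoothing at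
the scale `1 / N` in each coordinate direction. -/
noncomputable def resonantPart (ω : Fin n → ℝ) (N T : ℝ) :
    (BoundedContinuousFunction (Fin n → ℝ) ℂ) →L[ℂ] (BoundedContinuousFunction (Fin n → ℝ) ℂ) :=
  K.smearList ((T • ω) :: List.ofFn fun i => Pi.single i (1 / N))

variable {ω : Fin n → ℝ} {N T : ℝ}

theorem resonantPart_character (hN : 0 < N) (hT : 0 < T) (h : SmallDivisorBound ω N T)
    (k : Fin n → ℤ) :
    ∃ a : ℂ, K.resonantPart ω N T (character k) = a • character k ∧
      (intVec k ⬝ᵥ ω ≠ 0 → a = 0) := by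
  obtain ⟨a, ha, h0⟩ := K.smearList_character
    ((T • ω) :: List.ofFn fun i => Pi.single i (1 / N)) k
  refine ⟨a, ha, fun hk => ?_⟩
  by_cases hkN : ‖intVec k‖ < N
  · refine h0 _ List.mem_cons_self ?_
    rw [dotProduct_smul, smul_eq_mul, abs_mul, abs_of_pos hT]
    exact h k hkN hk
  · rw [pi_norm_lt_iff hN] at hkN
    push Not at hkN
    obtain ⟨i, hi⟩ := hkN
    refine h0 _ (List.mem_cons_of_mem _ ((List.mem_ofFn).2 ⟨i, rfl⟩)) ?_
    rw [dotProduct_single, abs_mul, abs_of_pos (one_div_pos.2 hN), mul_one_div,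
      le_div_iff₀ hN, one_mul]
    exact hi

theorem norm_resonantPart_le (F : BoundedContinuousFunction (Fin n → ℝ) ℂ) :
    ‖K.resonantPart ω N T F‖ ≤ K.mass ^ (n + 1) * ‖F‖ := by
  have h := K.norm_smearList_le ((T • ω) :: List.ofFn fun i => Pi.single i (1 / N)) F
  rwa [List.length_cons, List.length_ofFn] at h

/-- The resonant part of a function on the torus is invariant under the translations that leave all
resonant characters invariant. -/
theorem resonantPart_add (hN : 0 < N) (hT : 0 < T) (h : SmallDivisorBound ω N T)
    (F : BoundedContinuousFunction (Fin n → ℝ) ℂ)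
    (hF : ∀ (k : Fin n → ℤ) (θ : Fin n → ℝ), F (θ + intVec k) = F θ) {v : Fin n → ℝ}
    (hv : ∀ k : Fin n → ℤ, intVec k ⬝ᵥ ω = 0 → intVec k ⬝ᵥ v = 0) (θ : Fin n → ℝ) :
    K.resonantPart ω N T F (θ + v) = K.resonantPart ω N T F θ := by
  have hp : ∀ p ∈ Submodule.span ℂ (range (character (n := n))),
      K.resonantPart ω N T p (θ + v) = K.resonantPart ω N T p θ := by
    intro p hp
    induction hp using Submodule.span_induction with
    | mem p hp =>
      obtain ⟨k, rfl⟩ := hp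
      obtain ⟨a, ha, h0⟩ := K.resonantPart_character hN hT h k
      rw [ha]
      by_cases hk : intVec k ⬝ᵥ ω = 0
      · have : character k v = 1 := by
          rw [character_apply, hv k hk]
          simp
        simp [character_add, this]
      · simp [h0 hk]
    | zero => simp
    | add p q _ _ hp hq => simp [hp, hq]
    | smul c p _ hp => simp [hp]
  rw [← sub_eq_zero, ← norm_le_zero_iff]
  refine le_of_forall_pos_le_add fun ε hε => ?_
  set M := K.mass ^ (n + 1) with hM
  have hM0 : 0 ≤ M := pow_nonneg K.mass_nonneg _
  obtain ⟨p, hpm, hpF⟩ := exists_trigPoly_near F hF (ε := ε / (2 * M + 1)) (by positivity)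
  have h1 : ∀ x, ‖K.resonantPart ω N T F x - K.resonantPart ω N T p x‖ ≤
      M * (ε / (2 * M + 1)) := by
    intro x
    rw [← BoundedContinuousFunction.sub_apply, ← map_sub]
    exact (BoundedContinuousFunction.norm_coe_le_norm _ _).trans
      ((K.norm_resonantPart_le _).trans (mul_le_mul_of_nonneg_left hpF hM0))
  have h2 : K.resonantPart ω N T F (θ + v) - K.resonantPart ω N T F θ =
      (K.resonantPart ω N T F (θ + v) - K.resonantPart ω N T p (θ + v)) -
      (K.resonantPart ω N T F θ - K.resonantPart ω N T p θ) := by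
    rw [hp p hpm]
    ring
  rw [h2, zero_add]
  calc _ ≤ M * (ε / (2 * M + 1)) + M * (ε / (2 * M + 1)) :=
        (norm_sub_le _ _).trans (add_le_add (h1 _) (h1 _))
    _ = ε * (2 * M) / (2 * M + 1) := by ring
    _ ≤ ε := by
        rw [div_le_iff₀ (by positivity)]
        nlinarith

/-- A derivative in a direction that is orthogonal to all resonances has no resonant part. -/
theorem resonantPart_deriv (hN : 0 < N) (hT : 0 < T) (h : SmallDivisorBound ω N T)
    (F G : BoundedContinuousFunction (Fin n → ℝ) ℂ)
    (hF : ∀ (k : Fin n → ℤ) (θ : Fin n → ℝ), F (θ + intVec k) = F θ) {v : Fin n → ℝ}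
    (hv : ∀ k : Fin n → ℤ, intVec k ⬝ᵥ ω = 0 → intVec k ⬝ᵥ v = 0) {C : ℝ}
    (hG : ∀ θ (s : ℝ), ‖F (θ + s • v) - F θ - s * G θ‖ ≤ C * s ^ 2) (θ : Fin n → ℝ) :
    K.resonantPart ω N T G θ = 0 := by
  set M := K.mass ^ (n + 1) with hM
  have hM0 : 0 ≤ M := pow_nonneg K.mass_nonneg _
  have hC : 0 ≤ C := by
    have := (norm_nonneg _).trans (hG θ 1)
    simpa using this
  have hs : ∀ s : ℝ, 0 < s → s * ‖K.resonantPart ω N T G θ‖ ≤ M * (C * s ^ 2) := by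
    intro s hs
    let Fs : BoundedContinuousFunction (Fin n → ℝ) ℂ :=
      F.compContinuous ⟨fun θ => θ + s • v, by fun_prop⟩
    have e1 : K.resonantPart ω N T Fs θ = K.resonantPart ω N T F (θ + s • v) :=
      K.smearList_comp_add _ F Fs (s • v) (fun _ => rfl) θ
    rw [K.resonantPart_add hN hT h F hF (v := s • v)
      (fun k hk => by rw [dotProduct_smul, hv k hk, smul_zero])] at e1
    have e2 : K.resonantPart ω N T (Fs - F - (s : ℂ) • G) θ = -(s * K.resonantPart ω N T G θ) := by
      rw [map_sub, map_sub, map_smul]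
      simp [e1]
    have e3 : ‖Fs - F - (s : ℂ) • G‖ ≤ C * s ^ 2 :=
      (BoundedContinuousFunction.norm_le (by positivity)).2 fun x => hG x s
    calc s * ‖K.resonantPart ω N T G θ‖ = ‖K.resonantPart ω N T (Fs - F - (s : ℂ) • G) θ‖ := by
          rw [e2, norm_neg, norm_mul, Complex.norm_real, Real.norm_eq_abs, abs_of_pos hs]
      _ ≤ M * (C * s ^ 2) := (BoundedContinuousFunction.norm_coe_le_norm _ _).trans
          ((K.norm_resonantPart_le _).trans (mul_le_mul_of_nonneg_left e3 hM0))
  rw [← norm_le_zero_iff]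
  refine le_of_forall_pos_le_add fun ε hε => ?_
  have h1 := hs (ε / (M * C + 1)) (by positivity)
  set s := ε / (M * C + 1) with hsd
  have hs0 : 0 < s := by positivity
  have h2 : ‖K.resonantPart ω N T G θ‖ ≤ M * C * s := by
    refine le_of_mul_le_mul_left (h1.trans_eq (by ring)) hs0
  have h3 : s * (M * C + 1) = ε := div_mul_cancel₀ _ (by positivity)
  nlinarith

/-- The constant `c₂` in the term `c₂ κ t / N` of the averaging estimate. -/
noncomputable def smoothingConst (n : ℕ) : ℝ := K.mass * K.smearConst n

theorem smoothingConst_nonneg (n : ℕ) : 0 ≤ K.smoothingConst n :=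
  mul_nonneg K.mass_nonneg (K.smearConst_nonneg n)

/-- Averaging estimate: along a path that follows the direction `ω` up to a slow drift, a Lipschitz
function on the torus may be replaced by its resonant part in time integrals. -/
theorem norm_integral_sub_resonantPart_le (hN : 0 < N) (hT : 0 < T)
    (F : BoundedContinuousFunction (Fin n → ℝ) ℂ) {κ : ℝ} (hκ : 0 ≤ κ)
    (hF : ∀ x y, ‖F x - F y‖ ≤ κ * ‖x - y‖) {ζ : ℝ → (Fin n → ℝ)} {η : ℝ}
    (hζ : ∀ s u, ‖ζ s - ζ u‖ ≤ η * |s - u|) {t : ℝ} (ht : 0 ≤ t) :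
    ‖∫ s in (0 : ℝ)..t, (F (s • ω + ζ s) - K.resonantPart ω N T F (s • ω + ζ s))‖ ≤
      K.moment * (T * (2 * ‖F‖ + κ * η * t)) + K.smoothingConst n * (κ / N) * t := by
  have hη : 0 ≤ η := by
    have := (norm_nonneg _).trans (hζ 1 0)
    simpa using this
  have hζc : Continuous ζ := by
    refine (LipschitzWith.of_dist_le_mul (K := ⟨η, hη⟩) fun s u => ?_).continuous
    rw [dist_eq_norm, Real.dist_eq]
    exact hζ s u
  set l : List (Fin n → ℝ) := List.ofFn fun i => Pi.single i (1 / N) with hl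
  have hlN : ∀ w ∈ l, ‖w‖ ≤ 1 / N := by
    intro w hw
    obtain ⟨i, rfl⟩ := (List.mem_ofFn).1 hw
    rw [Pi.norm_single, Real.norm_eq_abs, abs_of_pos (one_div_pos.2 hN)]
  have hll : l.length = n := by simp [hl]
  have h1 : ∀ x, F x - K.resonantPart ω N T F x =
      -(K.smear (T • ω) F x - F x) + K.smear (T • ω) (F - K.smearList l F) x := by
    intro x
    rw [map_sub, BoundedContinuousFunction.sub_apply, resonantPart, smearList_cons]
    ring
  have h2 : ∀ x, ‖K.smear (T • ω) (F - K.smearList l F) x‖ ≤ K.smoothingConst n * (κ / N) := by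
    intro x
    have h3 := K.norm_smearList_sub_le l hlN F hκ hF
    rw [norm_sub_rev, hll] at h3
    calc _ ≤ K.mass * ‖F - K.smearList l F‖ :=
          (BoundedContinuousFunction.norm_coe_le_norm _ _).trans (K.norm_smear_le _ _)
      _ ≤ K.mass * (K.smearConst n * (κ * (1 / N))) :=
          mul_le_mul_of_nonneg_left h3 K.mass_nonneg
      _ = _ := by rw [smoothingConst]; ring
  simp_rw [h1]
  rw [intervalIntegral.integral_add (Continuous.intervalIntegrable (by fun_prop) _ _)
    (Continuous.intervalIntegrable (by fun_prop) _ _), intervalIntegral.integral_neg]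
  refine (norm_add_le _ _).trans (add_le_add ?_ ?_)
  · rw [norm_neg]
    exact K.norm_integral_smear_sub_le F hκ hF ω hT.le hζc hζ ht
  · have := intervalIntegral.norm_integral_le_of_norm_le_const (a := 0) (b := t)
      (f := fun s => K.smear (T • ω) (F - K.smearList l F) (s • ω + ζ s)) fun s _ => h2 _
    rwa [sub_zero, abs_of_nonneg ht] at this

end BandLimitedKernel

end MicroDiffusion

/-! ### Lipschitz functions on the torus and their time averages -/

namespace MicroDiffusion

variable {n : ℕ}

/-- A Lipschitz function on the torus `ℝⁿ / ℤⁿ`, with explicit constants. -/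
structure IsTorusLipschitz (F : (Fin n → ℝ) → ℝ) (B κ : ℝ) : Prop where
  periodic : ∀ (k : Fin n → ℤ) (θ : Fin n → ℝ), F (θ + intVec k) = F θ
  bound : ∀ θ, |F θ| ≤ B
  lipschitz : ∀ θ φ, |F θ - F φ| ≤ κ * ‖θ - φ‖

namespace IsTorusLipschitz

variable {F : (Fin n → ℝ) → ℝ} {B κ : ℝ}

theorem bound_nonneg (hF : IsTorusLipschitz F B κ) : 0 ≤ B := (abs_nonneg _).trans (hF.bound 0)

theorem continuous (hF : IsTorusLipschitz F B κ) : Continuous F := by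
  refine (LipschitzWith.of_dist_le_mul (K := κ.toNNReal) fun θ φ => ?_).continuous
  rw [Real.dist_eq, dist_eq_norm, Real.coe_toNNReal']
  exact (hF.lipschitz θ φ).trans
    (mul_le_mul_of_nonneg_right (le_max_left _ _) (norm_nonneg _))

/-- The function as a complex-valued bounded continuous function. -/
noncomputable def toComplex (hF : IsTorusLipschitz F B κ) :
    BoundedContinuousFunction (Fin n → ℝ) ℂ :=
  BoundedContinuousFunction.ofNormedAddCommGroup (fun θ => (F θ : ℂ))
    (Complex.continuous_ofReal.comp hF.continuous) B
    (fun θ => by rw [Complex.norm_real, Real.norm_eq_abs]; exact hF.bound θ)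

theorem toComplex_apply (hF : IsTorusLipschitz F B κ) (θ : Fin n → ℝ) :
    hF.toComplex θ = (F θ : ℂ) := rfl

theorem norm_toComplex_le (hF : IsTorusLipschitz F B κ) : ‖hF.toComplex‖ ≤ B :=
  (BoundedContinuousFunction.norm_le hF.bound_nonneg).2 fun θ => by
    rw [toComplex_apply, Complex.norm_real, Real.norm_eq_abs]; exact hF.bound θ

theorem toComplex_lipschitz (hF : IsTorusLipschitz F B κ) (θ φ : Fin n → ℝ) :
    ‖hF.toComplex θ - hF.toComplex φ‖ ≤ κ * ‖θ - φ‖ := by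
  rw [toComplex_apply, toComplex_apply, ← Complex.ofReal_sub, Complex.norm_real, Real.norm_eq_abs]
  exact hF.lipschitz θ φ

theorem toComplex_periodic (hF : IsTorusLipschitz F B κ) (k : Fin n → ℤ) (θ : Fin n → ℝ) :
    hF.toComplex (θ + intVec k) = hF.toComplex θ := by
  rw [toComplex_apply, toComplex_apply, hF.periodic]

variable (K : BandLimitedKernel) {ω : Fin n → ℝ} {N T : ℝ}

/-- A Lipschitz function on the torus is close, in time averages over paths that nearly follow `ω`,
to a function that is invariant under the translations orthogonal to the resonances. -/
theorem exists_invariant_near (hF : IsTorusLipschitz F B κ) (hκ : 0 ≤ κ) (hN : 0 < N) (hT : 0 < T)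
    (h : SmallDivisorBound ω N T) :
    ∃ m : (Fin n → ℝ) → ℝ,
      (∀ v : Fin n → ℝ, (∀ k : Fin n → ℤ, intVec k ⬝ᵥ ω = 0 → intVec k ⬝ᵥ v = 0) →
        ∀ θ, m (θ + v) = m θ) ∧
      ∀ (ζ : ℝ → (Fin n → ℝ)) (η : ℝ), (∀ s u, ‖ζ s - ζ u‖ ≤ η * |s - u|) → ∀ t, 0 ≤ t →
        |∫ s in (0 : ℝ)..t, (F (s • ω + ζ s) - m (s • ω + ζ s))| ≤
          K.moment * (T * (2 * B + κ * η * t)) + K.smoothingConst n * (κ / N) * t := by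
  refine ⟨fun θ => (K.resonantPart ω N T hF.toComplex θ).re, ?_, ?_⟩
  · intro v hv θ
    simp only [K.resonantPart_add hN hT h hF.toComplex hF.toComplex_periodic hv θ]
  · intro ζ η hζ t ht
    have hζc : Continuous ζ := by
      refine (LipschitzWith.of_dist_le_mul (K := η.toNNReal) fun s u => ?_).continuous
      rw [dist_eq_norm, Real.dist_eq, Real.coe_toNNReal']
      exact (hζ s u).trans (mul_le_mul_of_nonneg_right (le_max_left _ _) (abs_nonneg _))
    have h1 := K.norm_integral_sub_resonantPart_le (ω := ω) hN hT hF.toComplex hκ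
      hF.toComplex_lipschitz hζ ht
    have hi : IntervalIntegrable (fun s => hF.toComplex (s • ω + ζ s) -
        K.resonantPart ω N T hF.toComplex (s • ω + ζ s)) volume 0 t :=
      Continuous.intervalIntegrable (by fun_prop) _ _
    have h2 := (Complex.reCLM).intervalIntegral_comp_comm hi
    simp only [Complex.reCLM_apply, Complex.sub_re, toComplex_apply, Complex.ofReal_re] at h2
    rw [h2]
    refine (Complex.abs_re_le_norm _).trans (h1.trans ?_)
    have := hF.norm_toComplex_le
    have := K.moment_nonneg
    gcongr

/-- Time integrals of a derivative in a direction orthogonal to all resonances are small along any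
path that nearly follows `ω`. -/
theorem abs_integral_deriv_le {G : (Fin n → ℝ) → ℝ} {B' κ' C : ℝ}
    (hF : IsTorusLipschitz F B κ) (hG : IsTorusLipschitz G B' κ') (hκ' : 0 ≤ κ')
    (hN : 0 < N) (hT : 0 < T) (h : SmallDivisorBound ω N T) {v : Fin n → ℝ}
    (hv : ∀ k : Fin n → ℤ, intVec k ⬝ᵥ ω = 0 → intVec k ⬝ᵥ v = 0)
    (hFG : ∀ θ (s : ℝ), |F (θ + s • v) - F θ - s * G θ| ≤ C * s ^ 2)
    {ζ : ℝ → (Fin n → ℝ)} {η : ℝ} (hζ : ∀ s u, ‖ζ s - ζ u‖ ≤ η * |s - u|) {t : ℝ} (ht : 0 ≤ t) :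
    |∫ s in (0 : ℝ)..t, G (s • ω + ζ s)| ≤
      K.moment * (T * (2 * B' + κ' * η * t)) + K.smoothingConst n * (κ' / N) * t := by
  have h0 : ∀ θ, K.resonantPart ω N T hG.toComplex θ = 0 :=
    K.resonantPart_deriv hN hT h hF.toComplex hG.toComplex hF.toComplex_periodic hv (C := C)
      fun θ s => by
        simp only [toComplex_apply]
        rw [← Complex.ofReal_mul, ← Complex.ofReal_sub, ← Complex.ofReal_sub, Complex.norm_real]
        exact hFG θ s
  have h1 := K.norm_integral_sub_resonantPart_le (ω := ω) hN hT hG.toComplex hκ'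
    hG.toComplex_lipschitz hζ ht
  simp only [h0, sub_zero, toComplex_apply] at h1
  rw [intervalIntegral.integral_ofReal, Complex.norm_real] at h1
  refine h1.trans ?_
  have := hG.norm_toComplex_le
  have := K.moment_nonneg
  gcongr

end IsTorusLipschitz

theorem finite_setOf_norm_intVec_le (Q : ℝ) : {k : Fin n → ℤ | ‖intVec k‖ ≤ Q}.Finite := by
  refine (Set.finite_Icc (fun _ : Fin n => -⌈Q⌉) (fun _ => ⌈Q⌉)).subset fun k hk => ?_
  have h : ∀ i, |(k i : ℝ)| ≤ ⌈Q⌉ := fun i =>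
    ((norm_le_pi_norm (intVec k) i).trans hk).trans (Int.le_ceil Q)
  constructor <;> intro i
  · have := (abs_le.1 (h i)).1
    exact_mod_cast this
  · have := (abs_le.1 (h i)).2
    exact_mod_cast this

theorem exists_smallDivisorBound (ω : Fin n → ℝ) (N : ℝ) : ∃ T, 0 < T ∧ SmallDivisorBound ω N T := by
  have hfin := finite_setOf_norm_intVec_le (n := n) N
  refine ⟨1 + ∑ k ∈ hfin.toFinset, |intVec k ⬝ᵥ ω|⁻¹, by positivity, fun k hk hk0 => ?_⟩
  have hpos : 0 < |intVec k ⬝ᵥ ω| := abs_pos.2 hk0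
  have h1 : |intVec k ⬝ᵥ ω|⁻¹ ≤ ∑ k ∈ hfin.toFinset, |intVec k ⬝ᵥ ω|⁻¹ :=
    Finset.single_le_sum (f := fun k : Fin n → ℤ => |intVec k ⬝ᵥ ω|⁻¹)
      (fun _ _ => by positivity) (hfin.mem_toFinset.2 hk.le)
  calc (1 : ℝ) = |intVec k ⬝ᵥ ω|⁻¹ * |intVec k ⬝ᵥ ω| := (inv_mul_cancel₀ hpos.ne').symm
    _ ≤ _ := by gcongr; linarith

namespace IsTorusLipschitz

variable {F : (Fin n → ℝ) → ℝ} {B κ : ℝ} (K : BandLimitedKernel)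

/-- Time averages along linear flows on the torus converge, with a rate governed by the small
divisors. -/
theorem exists_tendsto_average (hF : IsTorusLipschitz F B κ) (hκ : 0 ≤ κ) (ω θ : Fin n → ℝ) :
    ∃ A : ℝ, Tendsto (fun t : ℝ => (1 / t) * ∫ s in (0 : ℝ)..t, F (θ + s • ω)) atTop (𝓝 A) ∧
      ∀ N T : ℝ, 0 < N → 0 < T → SmallDivisorBound ω N T → ∀ t, 0 ≤ t →
        |(∫ s in (0 : ℝ)..t, F (θ + s • ω)) - t * A| ≤
          K.moment * (T * (2 * B)) + 2 * (K.smoothingConst n * (κ / N)) * t := by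
  set a : ℝ → ℝ := fun t => (1 / t) * ∫ s in (0 : ℝ)..t, F (θ + s • ω) with ha
  have hB := hF.bound_nonneg
  have hc2 := K.smoothingConst_nonneg n
  have hc1 := K.moment_nonneg
  -- The averages are close to a constant that depends on `N`, for large times.
  have key : ∀ N T : ℝ, 0 < N → 0 < T → SmallDivisorBound ω N T → ∃ m : ℝ, ∀ t, 0 ≤ t →
      |(∫ s in (0 : ℝ)..t, F (θ + s • ω)) - t * m| ≤
        K.moment * (T * (2 * B)) + K.smoothingConst n * (κ / N) * t := by
    intro N T hN hT h
    obtain ⟨m, hmv, hm⟩ := hF.exists_invariant_near K hκ hN hT h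
    refine ⟨m θ, fun t ht => ?_⟩
    have h1 := hm (fun _ => θ) 0 (by simp) t ht
    have h2 : ∀ s : ℝ, m (s • ω + θ) = m θ := fun s => by
      rw [add_comm]
      exact hmv _ (fun k hk => by rw [dotProduct_smul, hk, smul_zero]) _
    simp only [h2] at h1
    have hc := hF.continuous
    rw [intervalIntegral.integral_sub (Continuous.intervalIntegrable (by fun_prop) _ _)
      (by simp), intervalIntegral.integral_const, sub_zero, smul_eq_mul, mul_zero, zero_mul,
      add_zero] at h1
    simpa only [add_comm] using h1
  have key' : ∀ N T m : ℝ, 0 < N → 0 < T → (∀ t, 0 ≤ t →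
      |(∫ s in (0 : ℝ)..t, F (θ + s • ω)) - t * m| ≤
        K.moment * (T * (2 * B)) + K.smoothingConst n * (κ / N) * t) → ∀ t, 0 < t →
      |a t - m| ≤ K.moment * (T * (2 * B)) / t + K.smoothingConst n * (κ / N) := by
    intro N T m hN hT hm t ht
    have h1 : a t - m = (1 / t) * ((∫ s in (0 : ℝ)..t, F (θ + s • ω)) - t * m) := by
      simp only [ha]
      field_simp
    rw [h1, abs_mul, abs_of_pos (one_div_pos.2 ht)]
    calc _ ≤ (1 / t) * (K.moment * (T * (2 * B)) + K.smoothingConst n * (κ / N) * t) :=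
          mul_le_mul_of_nonneg_left (hm t ht.le) (one_div_pos.2 ht).le
      _ = _ := by field_simp
  have hcauchy : Cauchy (map a atTop) := by
    rw [Metric.cauchy_iff]
    refine ⟨inferInstance, fun ε hε => ?_⟩
    set N : ℝ := 8 * (K.smoothingConst n * κ + 1) / ε with hN
    have hNpos : 0 < N := by positivity
    obtain ⟨T, hT, hTN⟩ := exists_smallDivisorBound ω N
    obtain ⟨m, hm⟩ := key N T hNpos hT hTN
    have hm' := key' N T m hNpos hT hm
    set R := 8 * (K.moment * (T * (2 * B)) + 1) / ε with hR
    have hRpos : 0 < R := by positivity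
    have hlim : ∀ t, R ≤ t → |a t - m| ≤ ε / 4 := by
      intro t ht
      have e1 : K.moment * (T * (2 * B)) / t ≤ ε / 8 := by
        rw [div_le_iff₀ (hRpos.trans_le ht)]
        have : ε / 8 * R = K.moment * (T * (2 * B)) + 1 := by rw [hR]; field_simp
        nlinarith
      have e2 : K.smoothingConst n * (κ / N) ≤ ε / 8 := by
        rw [← mul_div_assoc, div_le_iff₀ hNpos]
        have : ε / 8 * N = K.smoothingConst n * κ + 1 := by rw [hN]; field_simp
        linarith
      linarith [hm' t (hRpos.trans_le ht)]
    refine ⟨a '' Ici R, image_mem_map (Ici_mem_atTop R), ?_⟩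
    rintro _ ⟨t, ht, rfl⟩ _ ⟨u, hu, rfl⟩
    rw [Real.dist_eq]
    have h1 := abs_le.1 (hlim t ht)
    have h2 := abs_le.1 (hlim u hu)
    rw [abs_lt]
    constructor <;> linarith
  obtain ⟨A, hA⟩ := CompleteSpace.complete hcauchy
  refine ⟨A, hA, fun N T hN hT h t ht => ?_⟩
  obtain ⟨m, hm⟩ := key N T hN hT h
  have hm' := key' N T m hN hT hm
  have h1 : |A - m| ≤ 0 + K.smoothingConst n * (κ / N) := by
    have hA' : Tendsto a atTop (𝓝 A) := hA
    have h0 : Tendsto (fun t : ℝ => K.moment * (T * (2 * B)) / t) atTop (𝓝 0) :=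
      tendsto_const_nhds.div_atTop tendsto_id
    refine le_of_tendsto_of_tendsto ((hA'.sub_const m).abs) (h0.add_const _) ?_
    filter_upwards [eventually_gt_atTop 0] with t ht using hm' t ht
  have h2 : (∫ s in (0 : ℝ)..t, F (θ + s • ω)) - t * A =
      ((∫ s in (0 : ℝ)..t, F (θ + s • ω)) - t * m) - t * (A - m) := by ring
  rw [h2]
  refine (abs_sub _ _).trans ?_
  rw [abs_mul, abs_of_nonneg ht]
  nlinarith [hm t ht]

end IsTorusLipschitz

/-- At a point where the time average of `F` is differentiable, its derivative is the time average
of the derivative of `F`. -/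
theorem fderiv_average_eq {F G Φ : (Fin n → ℝ) → ℝ} {ω θ v : Fin n → ℝ} {A C : ℝ}
    (hFc : Continuous F) (hGc : Continuous G)
    (hFG : ∀ θ (s : ℝ), |F (θ + s • v) - F θ - s * G θ| ≤ C * s ^ 2)
    (hΦ : ∀ θ, Tendsto (fun t : ℝ => (1 / t) * ∫ s in (0 : ℝ)..t, F (θ + s • ω)) atTop (𝓝 (Φ θ)))
    (hA : Tendsto (fun t : ℝ => (1 / t) * ∫ s in (0 : ℝ)..t, G (θ + s • ω)) atTop (𝓝 A))
    (hd : DifferentiableAt ℝ Φ θ) : fderiv ℝ Φ θ v = A := by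
  have h1 : ∀ s : ℝ, |Φ (θ + s • v) - Φ θ - s * A| ≤ C * s ^ 2 := by
    intro s
    refine le_of_tendsto (((hΦ (θ + s • v)).sub (hΦ θ)).sub (hA.const_mul s)).abs ?_
    filter_upwards [eventually_gt_atTop 0] with t ht
    have e : (1 / t) * (∫ u in (0 : ℝ)..t, F (θ + s • v + u • ω)) -
        (1 / t) * (∫ u in (0 : ℝ)..t, F (θ + u • ω)) -
        s * ((1 / t) * ∫ u in (0 : ℝ)..t, G (θ + u • ω)) =
        (1 / t) * ∫ u in (0 : ℝ)..t, (F (θ + u • ω + s • v) - F (θ + u • ω) - s * G (θ + u • ω)) := by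
      rw [intervalIntegral.integral_sub (Continuous.intervalIntegrable (by fun_prop) _ _)
        (Continuous.intervalIntegrable (by fun_prop) _ _),
        intervalIntegral.integral_sub (Continuous.intervalIntegrable (by fun_prop) _ _)
        (Continuous.intervalIntegrable (by fun_prop) _ _), intervalIntegral.integral_const_mul]
      simp only [add_right_comm θ (s • v)]
      ring
    rw [e, abs_mul, abs_of_pos (one_div_pos.2 ht)]
    have h2 := intervalIntegral.norm_integral_le_of_norm_le_const (a := 0) (b := t)
      (f := fun u => F (θ + u • ω + s • v) - F (θ + u • ω) - s * G (θ + u • ω))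
      fun u _ => hFG (θ + u • ω) s
    rw [sub_zero, abs_of_pos ht, Real.norm_eq_abs] at h2
    calc _ ≤ (1 / t) * (C * s ^ 2 * t) := mul_le_mul_of_nonneg_left h2 (one_div_pos.2 ht).le
      _ = _ := by field_simp
  have h2 : HasDerivAt (fun s : ℝ => Φ (θ + s • v)) A 0 := by
    rw [hasDerivAt_iff_isLittleO]
    simp only [zero_smul, add_zero, sub_zero, smul_eq_mul]
    refine Asymptotics.IsBigO.trans_isLittleO (g := fun s : ℝ => s ^ 2) ?_ ?_
    · refine Asymptotics.IsBigO.of_bound C (Eventually.of_forall fun s => ?_)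
      rw [Real.norm_eq_abs, Real.norm_eq_abs, abs_of_nonneg (sq_nonneg s)]
      exact h1 s
    · simpa using Asymptotics.isLittleO_pow_pow (𝕜 := ℝ) (m := 1) (n := 2) (by norm_num)
  have h3 : HasDerivAt (fun s : ℝ => Φ (θ + s • v)) (fderiv ℝ Φ θ v) 0 :=
    hd.hasFDerivAt.hasLineDerivAt v
  exact h3.unique h2

end MicroDiffusion

/-! ### Rationality of the resonant subspace and small divisors -/

namespace MicroDiffusion

variable {n : ℕ}

/-- A positive integer `den` and integer vectors `vec i` such that `den⁻¹ • vec i` is the Euclidean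
orthogonal projection of the `i`-th basis vector onto the orthogonal complement of `Λ`. -/
structure IntegralProjection (Λ : Submodule ℝ (Fin n → ℝ)) where
  /-- The common denominator. -/
  den : ℝ
  /-- The multiples of the projections of the basis vectors. -/
  vec : Fin n → Fin n → ℤ
  den_pos : 0 < den
  orthogonal : ∀ i, ∀ v ∈ Λ, intVec (vec i) ⬝ᵥ v = 0
  sub_mem : ∀ i, den • Pi.single i 1 - intVec (vec i) ∈ Λ

theorem dotProduct_eq_zero_of_mem_resonantSubspace {ω x v : Fin n → ℝ}
    (hx : ∀ k : Fin n → ℤ, intVec k ⬝ᵥ ω = 0 → x ⬝ᵥ intVec k = 0)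
    (hv : v ∈ resonantSubspace ω) : x ⬝ᵥ v = 0 := by
  induction hv using Submodule.span_induction with
  | mem v hv =>
    obtain ⟨k, hk, rfl⟩ := hv
    exact hx k hk
  | zero => simp
  | add a b _ _ ha hb => rw [dotProduct_add, ha, hb, add_zero]
  | smul c a _ ha => rw [dotProduct_smul, ha, smul_zero]

/-- The complement of a rational subspace is rational: decompose the basis vectors over `ℚ`, where
the dot product is still positive definite, and clear denominators. -/
theorem nonempty_integralProjection (ω : Fin n → ℝ) :
    Nonempty (IntegralProjection (resonantSubspace ω)) := by
  let B : LinearMap.BilinForm ℚ (Fin n → ℚ) := dotProductBilin ℚ ℚ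
  have hB : ∀ x y, B x y = x ⬝ᵥ y := fun x y => rfl
  let W : Submodule ℚ (Fin n → ℚ) :=
    { carrier := {q | (fun i => (q i : ℝ)) ⬝ᵥ ω = 0}
      add_mem' := by
        intro a b ha hb
        simp only [mem_ofPred_eq, dotProduct, Pi.add_apply, Rat.cast_add, add_mul,
          Finset.sum_add_distrib] at ha hb ⊢
        rw [ha, hb, add_zero]
      zero_mem' := by simp [dotProduct]
      smul_mem' := by
        intro c a ha
        simp only [mem_ofPred_eq, dotProduct, Pi.smul_apply, smul_eq_mul, Rat.cast_mul, mul_assoc,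
          ← Finset.mul_sum] at ha ⊢
        rw [ha, mul_zero] }
  have hcompl : IsCompl W (B.orthogonal W) := by
    rw [LinearMap.BilinForm.isCompl_orthogonal_iff_disjoint]
    · rw [Submodule.disjoint_def]
      intro x hx hx'
      exact dotProduct_self_eq_zero.1 (hx' x hx)
    · intro x y h
      rwa [hB, dotProduct_comm] at h
  have hdec : ∀ i : Fin n, ∃ a ∈ W, ∃ b ∈ B.orthogonal W, a + b = Pi.single i 1 := fun i =>
    Submodule.mem_sup.1 (hcompl.sup_eq_top ▸ Submodule.mem_top)
  choose a ha b hb hab using hdec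
  let D : ℕ := ∏ i, ∏ j, (b i j).den
  have hD : 0 < D := Finset.prod_pos fun i _ => Finset.prod_pos fun j _ => (b i j).den_pos
  have hint : ∀ i j, ∃ m : ℤ, (m : ℚ) = D * b i j := by
    intro i j
    obtain ⟨c, hc⟩ : (b i j).den ∣ D :=
      (Finset.dvd_prod_of_mem (fun j => (b i j).den) (Finset.mem_univ j)).trans
        (Finset.dvd_prod_of_mem (fun i => ∏ j, (b i j).den) (Finset.mem_univ i))
    refine ⟨c * (b i j).num, ?_⟩
    rw [hc]
    push_cast
    rw [mul_comm ((b i j).den : ℚ), mul_assoc, Rat.den_mul_eq_num]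
  choose P hP using hint
  have hPR : ∀ i j, (P i j : ℝ) = D * (b i j : ℝ) := fun i j => by exact_mod_cast hP i j
  refine ⟨⟨D, P, by exact_mod_cast hD, fun i v hv =>
    dotProduct_eq_zero_of_mem_resonantSubspace (fun k hk => ?_) hv, fun i => ?_⟩⟩
  · have hkW : (fun j => (k j : ℚ)) ∈ W := by
      change (fun j => (((k j : ℤ) : ℚ) : ℝ)) ⬝ᵥ ω = 0
      simp only [Rat.cast_intCast]
      exact hk
    have h1 : (∑ j, (k j : ℚ) * b i j) = 0 := hb i _ hkW
    have h2 : (∑ j, (k j : ℝ) * (b i j : ℝ)) = 0 := by exact_mod_cast h1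
    simp only [dotProduct, intVec, hPR]
    calc _ = D * ∑ j, (k j : ℝ) * (b i j : ℝ) := by
          rw [Finset.mul_sum]
          exact Finset.sum_congr rfl fun j _ => by ring
      _ = 0 := by rw [h2, mul_zero]
  · have h1 : (D : ℝ) • Pi.single i 1 - intVec (P i) =
        intVec (fun j => (Pi.single i (D : ℤ) : Fin n → ℤ) j - P i j) := by
      ext j
      by_cases hij : j = i
      · subst hij
        simp [intVec]
      · simp [intVec, hij]
    have h2 : (D : ℝ) • Pi.single i 1 - intVec (P i) = (D : ℝ) • fun j => (a i j : ℝ) := by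
      ext j
      have h3 := congrFun (hab i) j
      have h4 : (a i j : ℝ) + (b i j : ℝ) = (Pi.single i 1 : Fin n → ℝ) j := by
        rw [← Rat.cast_add]
        have : a i j + b i j = (Pi.single i 1 : Fin n → ℚ) j := h3
        rw [this]
        by_cases hij : j = i
        · subst hij
          simp
        · simp [hij]
      simp only [Pi.sub_apply, Pi.smul_apply, smul_eq_mul, intVec, hPR, ← h4]
      ring
    refine Submodule.subset_span ⟨_, ?_, h1⟩
    rw [← h1, h2, smul_dotProduct]
    have : (fun j => (a i j : ℝ)) ⬝ᵥ ω = 0 := ha i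
    rw [this, smul_zero]

namespace IntegralProjection

variable {Λ : Submodule ℝ (Fin n → ℝ)} (P : IntegralProjection Λ)

/-- A bound for the entries of the projection matrix. -/
noncomputable def size : ℝ := 1 + ∑ i, ∑ j, |(P.vec i j : ℝ)|

theorem one_le_size : 1 ≤ P.size :=
  le_add_of_nonneg_right (Finset.sum_nonneg fun _ _ => Finset.sum_nonneg fun _ _ => abs_nonneg _)

theorem size_pos : 0 < P.size := zero_lt_one.trans_le P.one_le_size

theorem sum_abs_le_size (i : Fin n) : ∑ j, |(P.vec i j : ℝ)| ≤ P.size :=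
  (Finset.single_le_sum (f := fun i => ∑ j, |(P.vec i j : ℝ)|)
    (fun _ _ => Finset.sum_nonneg fun _ _ => abs_nonneg _) (Finset.mem_univ i)).trans
    (le_add_of_nonneg_left zero_le_one)

theorem norm_vec_le_size (i : Fin n) : ‖intVec (P.vec i)‖ ≤ P.size := by
  refine (pi_norm_le_iff_of_nonneg P.size_pos.le).2 fun j => ?_
  exact (Finset.single_le_sum (f := fun j => |(P.vec i j : ℝ)|)
    (fun _ _ => abs_nonneg _) (Finset.mem_univ j)).trans (P.sum_abs_le_size i)

theorem dotProduct_intVec_vec (i : Fin n) (x : Fin n → ℝ) (hx : ∀ v ∈ Λ, v ⬝ᵥ x = 0) :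
    intVec (P.vec i) ⬝ᵥ x = P.den * x i := by
  have h := hx _ (P.sub_mem i)
  rw [sub_dotProduct, smul_dotProduct, single_one_dotProduct, smul_eq_mul] at h
  linarith

theorem vec_symm (i j : Fin n) : (P.vec i j : ℝ) = P.vec j i := by
  have h : ∀ i j, intVec (P.vec i) ⬝ᵥ intVec (P.vec j) = P.den * P.vec j i := fun i j =>
    P.dotProduct_intVec_vec i _ fun v hv => by rw [dotProduct_comm]; exact P.orthogonal j v hv
  have h1 := h i j
  rw [dotProduct_comm, h j i] at h1
  exact mul_left_cancel₀ P.den_pos.ne' h1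

/-- The distance to `Λ` is controlled by the scalar products with the vectors `vec i`. -/
theorem infDist_le (x : Fin n → ℝ) {r : ℝ} (hr : 0 ≤ r)
    (hx : ∀ i, |intVec (P.vec i) ⬝ᵥ x| ≤ P.den * r) : Metric.infDist x (Λ : Set (Fin n → ℝ)) ≤ r := by
  have hmem : (P.den⁻¹ • ∑ i, x i • (P.den • Pi.single i 1 - intVec (P.vec i))) ∈ Λ :=
    Λ.smul_mem _ (Λ.sum_mem fun i _ => Λ.smul_mem _ (P.sub_mem i))
  refine (Metric.infDist_le_dist_of_mem hmem).trans ?_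
  rw [dist_eq_norm]
  refine (pi_norm_le_iff_of_nonneg hr).2 fun j => ?_
  have h1 : (x - P.den⁻¹ • ∑ i, x i • (P.den • Pi.single i 1 - intVec (P.vec i))) j =
      P.den⁻¹ * (intVec (P.vec j) ⬝ᵥ x) := by
    have h2 : ∑ i, x i * (P.den * (Pi.single i 1 : Fin n → ℝ) j) = P.den * x j := by
      rw [Finset.sum_eq_single j]
      · simp [mul_comm]
      · intro i _ hij
        simp [Pi.single_eq_of_ne hij.symm]
      · simp
    simp only [Pi.sub_apply, Pi.smul_apply, Finset.sum_apply, smul_eq_mul, mul_sub,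
      Finset.sum_sub_distrib, h2]
    rw [inv_mul_cancel_left₀ P.den_pos.ne', sub_sub_cancel, dotProduct]
    congr 1
    refine Finset.sum_congr rfl fun i _ => ?_
    simp only [intVec]
    rw [P.vec_symm i j, mul_comm]
  rw [h1, Real.norm_eq_abs, abs_mul, abs_of_pos (inv_pos.2 P.den_pos), inv_mul_le_iff₀ P.den_pos]
  exact hx j

end IntegralProjection

theorem dotProduct_frequency_eq_zero {ω v : Fin n → ℝ} (hv : v ∈ resonantSubspace ω) :
    v ⬝ᵥ ω = 0 := by
  rw [dotProduct_comm]
  exact dotProduct_eq_zero_of_mem_resonantSubspace (fun k hk => by rwa [dotProduct_comm]) hv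

theorem inv_abs_dotProduct_le_Psi {ω : Fin n → ℝ} {k : Fin n → ℤ} {Q : ℝ}
    (hk : k ∈ transverseInt ω) (hkQ : ‖intVec k‖ ≤ Q) : |intVec k ⬝ᵥ ω|⁻¹ ≤ Psi ω Q :=
  le_csSup (((finite_setOf_norm_intVec_le Q).subset fun _ h => h.2).image _).bddAbove
    ⟨k, ⟨hk, hkQ⟩, rfl⟩

namespace IntegralProjection

variable {ω : Fin n → ℝ} (P : IntegralProjection (resonantSubspace ω))

/-- The function `Ψ`, defined with the integer vectors orthogonal to the resonances only, controls
the small divisors of all integer vectors. -/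
theorem smallDivisorBound (Q : ℝ) : SmallDivisorBound ω (Q / P.size) (P.den * Psi ω Q) := by
  intro k hk hk0
  let k' : Fin n → ℤ := fun j => ∑ i, k i * P.vec i j
  have hk' : intVec k' = ∑ i, (k i : ℝ) • intVec (P.vec i) := by
    ext j
    simp [intVec, k']
  have hdot : intVec k' ⬝ᵥ ω = P.den * (intVec k ⬝ᵥ ω) := by
    rw [hk', sum_dotProduct]
    simp_rw [smul_dotProduct, P.dotProduct_intVec_vec _ ω fun v hv => dotProduct_frequency_eq_zero hv]
    rw [dotProduct, Finset.mul_sum]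
    refine Finset.sum_congr rfl fun i _ => ?_
    simp only [intVec, smul_eq_mul]
    ring
  have hne : intVec k' ⬝ᵥ ω ≠ 0 := by
    rw [hdot]
    exact mul_ne_zero P.den_pos.ne' hk0
  have htr : k' ∈ transverseInt ω := by
    refine ⟨fun h => hne ?_, fun v hv => ?_⟩
    · rw [h]
      simp [intVec, dotProduct]
    · rw [hk', sum_dotProduct]
      simp [smul_dotProduct, P.orthogonal _ v hv]
  have hnorm : ‖intVec k'‖ ≤ Q := by
    have h1 : ‖intVec k'‖ ≤ ‖intVec k‖ * P.size := by
      refine (pi_norm_le_iff_of_nonneg (mul_nonneg (norm_nonneg _) P.size_pos.le)).2 fun j => ?_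
      have h2 : intVec k' j = ∑ i, intVec k i * (P.vec j i : ℝ) := by
        rw [hk']
        simp only [Finset.sum_apply, Pi.smul_apply, smul_eq_mul, intVec]
        exact Finset.sum_congr rfl fun i _ => by rw [P.vec_symm i j]
      rw [h2]
      refine (norm_sum_le _ _).trans ?_
      calc ∑ i, ‖intVec k i * (P.vec j i : ℝ)‖ ≤ ∑ i, ‖intVec k‖ * |(P.vec j i : ℝ)| := by
            refine Finset.sum_le_sum fun i _ => ?_
            rw [norm_mul, Real.norm_eq_abs (P.vec j i : ℝ)]
            exact mul_le_mul_of_nonneg_right (norm_le_pi_norm _ i) (abs_nonneg _)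
        _ = ‖intVec k‖ * ∑ i, |(P.vec j i : ℝ)| := by rw [Finset.mul_sum]
        _ ≤ _ := mul_le_mul_of_nonneg_left (P.sum_abs_le_size j) (norm_nonneg _)
    refine h1.trans ?_
    have := (lt_div_iff₀ P.size_pos).1 hk
    exact this.le
  have hΨ := inv_abs_dotProduct_le_Psi htr hnorm
  have hpos : 0 < |intVec k' ⬝ᵥ ω| := abs_pos.2 hne
  calc (1 : ℝ) = |intVec k' ⬝ᵥ ω|⁻¹ * |intVec k' ⬝ᵥ ω| := (inv_mul_cancel₀ hpos.ne').symm
    _ ≤ Psi ω Q * |intVec k' ⬝ᵥ ω| := mul_le_mul_of_nonneg_right hΨ hpos.le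
    _ = P.den * Psi ω Q * |intVec k ⬝ᵥ ω| := by
      rw [hdot, abs_mul, abs_of_pos P.den_pos]
      ring

/-- The lower bound `|k · ω|⁻¹ ≥ (n |k| |ω|)⁻¹` for one transverse integer vector `k`, which exists
because `ω` is not zero. -/
theorem inv_le_Psi (hω : ω ≠ 0) {Q : ℝ} (hQ : P.size ≤ Q) : (n * P.size * ‖ω‖)⁻¹ ≤ Psi ω Q := by
  obtain ⟨i, hi⟩ := Function.ne_iff.1 hω
  have hdot := P.dotProduct_intVec_vec i ω fun v hv => dotProduct_frequency_eq_zero hv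
  have hne : intVec (P.vec i) ⬝ᵥ ω ≠ 0 := by
    rw [hdot]
    exact mul_ne_zero P.den_pos.ne' hi
  have htr : P.vec i ∈ transverseInt ω := by
    refine ⟨fun h => hne ?_, P.orthogonal i⟩
    rw [h]
    simp [intVec, dotProduct]
  refine le_trans ?_ (inv_abs_dotProduct_le_Psi htr ((P.norm_vec_le_size i).trans hQ))
  refine inv_anti₀ (abs_pos.2 hne) ?_
  rw [dotProduct]
  refine (Finset.abs_sum_le_sum_abs _ _).trans ?_
  calc ∑ j, |intVec (P.vec i) j * ω j| ≤ ∑ _j : Fin n, P.size * ‖ω‖ := by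
        refine Finset.sum_le_sum fun j _ => ?_
        rw [abs_mul]
        exact mul_le_mul ((norm_le_pi_norm (intVec (P.vec i)) j).trans (P.norm_vec_le_size i))
          (norm_le_pi_norm ω j) (abs_nonneg _) P.size_pos.le
    _ = _ := by simp [mul_assoc]

end IntegralProjection

/-- Below the supremum that defines `Δ(x)` there is an admissible `Q` that is at least `Δ(x) / 2`. -/
theorem exists_Q_of_Delta_pos {ω : Fin n → ℝ} {x : ℝ} (h : 0 < Delta ω x) :
    ∃ Q, Delta ω x / 2 < Q ∧ Q * Psi ω Q ≤ x := by
  have hne : {Q | Qmin ω ≤ Q ∧ Q * Psi ω Q ≤ x}.Nonempty := by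
    by_contra hemp
    rw [not_nonempty_iff_eq_empty] at hemp
    rw [Delta, hemp, Real.sSup_empty] at h
    exact lt_irrefl _ h
  obtain ⟨Q, hQ, hlt⟩ := exists_lt_of_lt_csSup hne (show Delta ω x / 2 < Delta ω x by linarith)
  exact ⟨Q, hlt, hQ.2⟩

end MicroDiffusion

/-! ### Partial derivatives of functions with bounded norm -/

namespace MicroDiffusion

variable {n : ℕ}

theorem abs_iteratedFDeriv_le_one {ι E : Type*} [NormedAddCommGroup E] [NormedSpace ℝ E]
    {b : ι → E} {k : ℕ} {S : Set E} {u : E → ℝ} (hu : cNorm b k S u ≤ 1) {x : E} (hx : x ∈ S)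
    {m : ℕ} (hm : m ≤ k) (v : Fin m → ι) : |iteratedFDeriv ℝ m u x (fun j => b (v j))| ≤ 1 := by
  have h : ‖iteratedFDeriv ℝ m u x (fun j => b (v j))‖ₑ ≤ 1 := by
    refine le_trans ?_ hu
    refine le_trans ?_ (le_iSup₂ x hx)
    refine le_trans ?_ (le_iSup₂ m hm)
    exact le_iSup (fun v : Fin m → ι => ‖iteratedFDeriv ℝ m u x (fun j => b (v j))‖ₑ) v
  rw [← enorm_one (G := ℝ), enorm_le_iff_norm_le] at h
  simpa using h

section PartialDerivatives

variable {ι E : Type*} [NormedAddCommGroup E] [NormedSpace ℝ E] {b : ι → E}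
  {S : Set E} {u : E → ℝ}

/-- A linear form that is at most `1` on a basis whose coordinate functions have norm at most `1`
is bounded by the number of basis vectors. -/
theorem norm_le_card_of_basis_le_one [Fintype ι] (A : E →L[ℝ] ℝ) (coord : E → ι → ℝ)
    (hsum : ∀ x, ∑ i, coord x i • b i = x) (hcoord : ∀ x i, |coord x i| ≤ ‖x‖)
    (hA : ∀ i, |A (b i)| ≤ 1) : ‖A‖ ≤ Fintype.card ι := by
  refine A.opNorm_le_bound (Nat.cast_nonneg _) fun x => ?_
  conv_lhs => rw [← hsum x]
  rw [map_sum]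
  refine (norm_sum_le _ _).trans ?_
  calc ∑ i, ‖A (coord x i • b i)‖ ≤ ∑ _i : ι, ‖x‖ := by
        refine Finset.sum_le_sum fun i _ => ?_
        rw [map_smul, smul_eq_mul, norm_mul]
        calc _ ≤ ‖x‖ * 1 := mul_le_mul (hcoord x i) (hA i) (abs_nonneg _) (norm_nonneg _)
          _ = _ := mul_one _
    _ = _ := by simp

theorem abs_fderiv_basis_le_one {k : ℕ} (hk : 1 ≤ k) (hu : cNorm b k S u ≤ 1) {x : E} (hx : x ∈ S)
    (i : ι) : |fderiv ℝ u x (b i)| ≤ 1 := by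
  have := abs_iteratedFDeriv_le_one hu hx hk (fun _ => i)
  rwa [iteratedFDeriv_one_apply] at this

theorem abs_sub_le_of_cNorm_le_one [Fintype ι] {k : ℕ} (hk : 1 ≤ k) (hS : IsOpen S) (hSc : Convex ℝ S)
    (hd : DifferentiableOn ℝ u S) (hu : cNorm b k S u ≤ 1) (coord : E → ι → ℝ)
    (hsum : ∀ x, ∑ i, coord x i • b i = x) (hcoord : ∀ x i, |coord x i| ≤ ‖x‖)
    {x y : E} (hx : x ∈ S) (hy : y ∈ S) : |u x - u y| ≤ Fintype.card ι * ‖x - y‖ :=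
  hSc.norm_image_sub_le_of_norm_fderiv_le (𝕜 := ℝ) (fun _ hz => hd.differentiableAt (hS.mem_nhds hz))
    (fun _ hz => norm_le_card_of_basis_le_one _ coord hsum hcoord
      fun i => abs_fderiv_basis_le_one hk hu hz i) hy hx

theorem abs_fderiv_sub_le_of_cNorm_le_one [Fintype ι] {k : ℕ} (hk : 2 ≤ k) (hS : IsOpen S) (hSc : Convex ℝ S)
    (hd : ContDiffOn ℝ 2 u S) (hu : cNorm b k S u ≤ 1) (coord : E → ι → ℝ)
    (hsum : ∀ x, ∑ i, coord x i • b i = x) (hcoord : ∀ x i, |coord x i| ≤ ‖x‖) (i : ι)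
    {x y : E} (hx : x ∈ S) (hy : y ∈ S) :
    |fderiv ℝ u x (b i) - fderiv ℝ u y (b i)| ≤ Fintype.card ι * ‖x - y‖ := by
  have hd' : DifferentiableOn ℝ (fderiv ℝ u) S :=
    (hd.fderiv_of_isOpen hS (m := 1) (by norm_num)).differentiableOn (by norm_num)
  have hA : ∀ z ∈ S, HasFDerivAt (fun z => fderiv ℝ u z (b i))
      ((fderiv ℝ (fderiv ℝ u) z).flip (b i)) z := fun z hz =>
    ((hd'.differentiableAt (hS.mem_nhds hz)).hasFDerivAt.clm_apply
      (hasFDerivAt_const (b i) z)).congr_fderiv (by ext; simp)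
  refine hSc.norm_image_sub_le_of_norm_hasFDerivWithin_le
    (fun z hz => (hA z hz).hasFDerivWithinAt)
    (fun z hz => norm_le_card_of_basis_le_one _ coord hsum hcoord fun j => ?_) hy hx
  have := abs_iteratedFDeriv_le_one hu hz hk ![j, i]
  rw [iteratedFDeriv_two_apply] at this
  simpa using this

end PartialDerivatives

/-- First order Taylor estimate in a direction `v` along which the derivative is Lipschitz. -/
theorem abs_sub_sub_le_of_lipschitz_deriv {E : Type*} [NormedAddCommGroup E] [NormedSpace ℝ E]
    {F G : E → ℝ} {v : E} {κ : ℝ} (hκ : 0 ≤ κ)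
    (hd : ∀ θ, HasDerivAt (fun s : ℝ => F (θ + s • v)) (G θ) 0)
    (hG : ∀ θ φ, |G θ - G φ| ≤ κ * ‖θ - φ‖) (θ : E) (s : ℝ) :
    |F (θ + s • v) - F θ - s * G θ| ≤ κ * ‖v‖ * s ^ 2 := by
  have hd' : ∀ t : ℝ, HasDerivAt (fun s : ℝ => F (θ + s • v) - s * G θ)
      (G (θ + t • v) - G θ) t := by
    intro t
    have h1 := hd (θ + t • v)
    have h2 : HasDerivAt (fun s : ℝ => F (θ + s • v)) (G (θ + t • v)) t := by
      have h3 : HasDerivAt (fun s : ℝ => s - t) 1 t := (hasDerivAt_id t).sub_const t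
      have h4 := HasDerivAt.scomp_of_eq t h1 h3 (sub_self t).symm
      rw [one_smul] at h4
      refine h4.congr_of_eventuallyEq (Eventually.of_forall fun s => ?_)
      simp only [Function.comp_apply]
      rw [sub_smul, add_assoc, add_sub_cancel]
    have h5 := h2.sub ((hasDerivAt_id t).mul_const (G θ))
    rw [one_mul] at h5
    exact h5
  have h := (convex_uIcc (0 : ℝ) s).norm_image_sub_le_of_norm_hasDerivWithin_le
    (C := κ * (|s| * ‖v‖)) (fun t _ => (hd' t).hasDerivWithinAt) (fun t ht => ?_)
    left_mem_uIcc right_mem_uIcc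
  · simp only [zero_smul, add_zero, zero_mul, sub_zero, Real.norm_eq_abs] at h
    calc _ = |F (θ + s • v) - s * G θ - F θ| := by ring_nf
      _ ≤ κ * (|s| * ‖v‖) * |s| := h
      _ = κ * ‖v‖ * s ^ 2 := by rw [← sq_abs s]; ring
  · refine (hG _ _).trans ?_
    rw [add_sub_cancel_left, norm_smul, Real.norm_eq_abs]
    have h3 : |t| ≤ |s| := by
      have := abs_sub_left_of_mem_uIcc ht
      simpa using this
    gcongr

theorem sum_smul_stdVec (x : Fin n → ℝ) : ∑ i, x i • stdVec n i = x := by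
  ext j
  simp [stdVec, Finset.sum_apply, Pi.single_apply]

/-- The coordinates with respect to the canonical basis of `ℝⁿ × ℝⁿ`. -/
def coordProd (p : (Fin n → ℝ) × (Fin n → ℝ)) : Fin n ⊕ Fin n → ℝ := Sum.elim p.1 p.2

theorem sum_smul_stdVecProd (p : (Fin n → ℝ) × (Fin n → ℝ)) :
    ∑ i, coordProd p i • stdVecProd n i = p := by
  ext j <;> simp [stdVecProd, coordProd, Prod.fst_sum, Prod.snd_sum, Finset.sum_apply,
    Pi.single_apply]

theorem abs_coordProd_le (p : (Fin n → ℝ) × (Fin n → ℝ)) (i : Fin n ⊕ Fin n) :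
    |coordProd p i| ≤ ‖p‖ := by
  rcases i with i | i
  · exact (norm_le_pi_norm p.1 i).trans (norm_fst_le p)
  · exact (norm_le_pi_norm p.2 i).trans (norm_snd_le p)

theorem isOpen_actionBall : IsOpen (actionBall n) := Metric.isOpen_ball

theorem isOpen_phaseSpace : IsOpen (phaseSpace n) := isOpen_univ.prod isOpen_actionBall

theorem convex_phaseSpace : Convex ℝ (phaseSpace n) := convex_univ.prod (convex_ball 0 1)

theorem mem_phaseSpace {p : (Fin n → ℝ) × (Fin n → ℝ)} : p ∈ phaseSpace n ↔ p.2 ∈ actionBall n := by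
  simp [phaseSpace]

theorem abs_grad_sub_le {h : (Fin n → ℝ) → ℝ} (hh : ContDiffOn ℝ 3 h (actionBall n))
    (hh1 : cNorm (stdVec n) 2 (actionBall n) h ≤ 1) {I J : Fin n → ℝ} (hI : I ∈ actionBall n)
    (hJ : J ∈ actionBall n) : ‖grad h I - grad h J‖ ≤ n * ‖I - J‖ := by
  refine (pi_norm_le_iff_of_nonneg (by positivity)).2 fun i => ?_
  have := abs_fderiv_sub_le_of_cNorm_le_one le_rfl isOpen_actionBall (convex_ball 0 1)
    (hh.of_le (by norm_num)) hh1 (fun x => x) sum_smul_stdVec (fun x i => norm_le_pi_norm x i)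
    i hI hJ
  rwa [Fintype.card_fin] at this

theorem norm_grad_le {h : (Fin n → ℝ) → ℝ}
    (hh1 : cNorm (stdVec n) 2 (actionBall n) h ≤ 1) {I : Fin n → ℝ} (hI : I ∈ actionBall n) :
    ‖grad h I‖ ≤ 1 :=
  (pi_norm_le_iff_of_nonneg zero_le_one).2 fun i => abs_fderiv_basis_le_one (by norm_num) hh1 hI i

section Perturbation

variable {f : (Fin n → ℝ) × (Fin n → ℝ) → ℝ}

theorem abs_fderiv_prod_sub_le (hf : ContDiffOn ℝ 3 f (phaseSpace n))
    (hf1 : cNorm (stdVecProd n) 3 (phaseSpace n) f ≤ 1) (i : Fin n ⊕ Fin n)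
    {p q : (Fin n → ℝ) × (Fin n → ℝ)} (hp : p ∈ phaseSpace n) (hq : q ∈ phaseSpace n) :
    |fderiv ℝ f p (stdVecProd n i) - fderiv ℝ f q (stdVecProd n i)| ≤ 2 * n * ‖p - q‖ := by
  have := abs_fderiv_sub_le_of_cNorm_le_one (by norm_num) isOpen_phaseSpace convex_phaseSpace
    (hf.of_le (by norm_num)) hf1 coordProd sum_smul_stdVecProd abs_coordProd_le i hp hq
  rw [Fintype.card_sum, Fintype.card_fin] at this
  push_cast at this
  rwa [← two_mul] at this

theorem fderiv_prod_left_eq_sum (p : (Fin n → ℝ) × (Fin n → ℝ)) (v : Fin n → ℝ) :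
    fderiv ℝ f p (v, 0) = ∑ i, v i * fderiv ℝ f p (stdVecProd n (Sum.inl i)) := by
  have h : ((v, 0) : (Fin n → ℝ) × (Fin n → ℝ)) = ∑ i, v i • stdVecProd n (Sum.inl i) := by
    ext j <;> simp [stdVecProd, Prod.fst_sum, Prod.snd_sum, Finset.sum_apply, Pi.single_apply]
  rw [h, map_sum]
  simp

theorem abs_fderiv_left_sub_le (hf : ContDiffOn ℝ 3 f (phaseSpace n))
    (hf1 : cNorm (stdVecProd n) 3 (phaseSpace n) f ≤ 1) (v : Fin n → ℝ)
    {p q : (Fin n → ℝ) × (Fin n → ℝ)} (hp : p ∈ phaseSpace n) (hq : q ∈ phaseSpace n) :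
    |fderiv ℝ f p (v, 0) - fderiv ℝ f q (v, 0)| ≤ (∑ i, |v i|) * (2 * n) * ‖p - q‖ := by
  rw [fderiv_prod_left_eq_sum, fderiv_prod_left_eq_sum, ← Finset.sum_sub_distrib]
  refine (Finset.abs_sum_le_sum_abs _ _).trans ?_
  rw [mul_assoc, Finset.sum_mul]
  refine Finset.sum_le_sum fun i _ => ?_
  rw [← mul_sub, abs_mul]
  exact mul_le_mul_of_nonneg_left (abs_fderiv_prod_sub_le hf hf1 _ hp hq) (abs_nonneg _)

theorem abs_fderiv_left_le (hf1 : cNorm (stdVecProd n) 3 (phaseSpace n) f ≤ 1) (v : Fin n → ℝ)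
    {p : (Fin n → ℝ) × (Fin n → ℝ)} (hp : p ∈ phaseSpace n) :
    |fderiv ℝ f p (v, 0)| ≤ ∑ i, |v i| := by
  rw [fderiv_prod_left_eq_sum]
  refine (Finset.abs_sum_le_sum_abs _ _).trans (Finset.sum_le_sum fun i _ => ?_)
  rw [abs_mul]
  exact mul_le_of_le_one_right (abs_nonneg _) (abs_fderiv_basis_le_one (by norm_num) hf1 hp _)

theorem isTorusLipschitz_section (hf : ContDiffOn ℝ 3 f (phaseSpace n)) (hper : AnglePeriodic f)
    (hf1 : cNorm (stdVecProd n) 3 (phaseSpace n) f ≤ 1) {I : Fin n → ℝ} (hI : I ∈ actionBall n) :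
    IsTorusLipschitz (fun θ => f (θ, I)) 1 (2 * n) where
  periodic k θ := hper k θ I hI
  bound θ := by
    have := abs_iteratedFDeriv_le_one hf1 (mem_phaseSpace.2 hI : (θ, I) ∈ phaseSpace n)
      (Nat.zero_le 3) Fin.elim0
    rwa [iteratedFDeriv_zero_apply] at this
  lipschitz θ φ := by
    have := abs_sub_le_of_cNorm_le_one (by norm_num) isOpen_phaseSpace convex_phaseSpace
      (hf.differentiableOn (by norm_num)) hf1 coordProd sum_smul_stdVecProd abs_coordProd_le
      (mem_phaseSpace.2 hI : (θ, I) ∈ phaseSpace n) (mem_phaseSpace.2 hI : (φ, I) ∈ phaseSpace n)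
    rw [Fintype.card_sum, Fintype.card_fin] at this
    push_cast at this
    rw [← two_mul] at this
    simpa [Prod.norm_def] using this

theorem isTorusLipschitz_fderiv_section (hf : ContDiffOn ℝ 3 f (phaseSpace n))
    (hper : AnglePeriodic f) (hf1 : cNorm (stdVecProd n) 3 (phaseSpace n) f ≤ 1)
    {I : Fin n → ℝ} (hI : I ∈ actionBall n) (v : Fin n → ℝ) :
    IsTorusLipschitz (fun θ => fderiv ℝ f (θ, I) (v, 0)) (∑ i, |v i|) ((∑ i, |v i|) * (2 * n)) where
  periodic k θ := by
    have h1 : (fun p : (Fin n → ℝ) × (Fin n → ℝ) => f (p + (intVec k, 0))) =ᶠ[𝓝 (θ, I)] f := by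
      filter_upwards [isOpen_phaseSpace.mem_nhds (mem_phaseSpace.2 hI : (θ, I) ∈ phaseSpace n)]
        with p hp
      have := hper k p.1 p.2 (mem_phaseSpace.1 hp)
      simpa [Prod.add_def] using this
    have h2 := h1.fderiv_eq (𝕜 := ℝ)
    rw [fderiv_comp_add_right] at h2
    simp only [Prod.mk_add_mk, add_zero] at h2
    rw [h2]
  bound θ := abs_fderiv_left_le hf1 v (mem_phaseSpace.2 hI)
  lipschitz θ φ := by
    have := abs_fderiv_left_sub_le hf hf1 v (mem_phaseSpace.2 hI : (θ, I) ∈ phaseSpace n)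
      (mem_phaseSpace.2 hI : (φ, I) ∈ phaseSpace n)
    simpa [Prod.norm_def] using this

theorem differentiableAt_of_mem_phaseSpace (hf : ContDiffOn ℝ 3 f (phaseSpace n))
    {p : (Fin n → ℝ) × (Fin n → ℝ)} (hp : p ∈ phaseSpace n) : DifferentiableAt ℝ f p :=
  (hf.differentiableOn (by norm_num)).differentiableAt (isOpen_phaseSpace.mem_nhds hp)

theorem abs_section_taylor_le (hf : ContDiffOn ℝ 3 f (phaseSpace n))
    (hper : AnglePeriodic f) (hf1 : cNorm (stdVecProd n) 3 (phaseSpace n) f ≤ 1)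
    {I : Fin n → ℝ} (hI : I ∈ actionBall n) (v θ : Fin n → ℝ) (s : ℝ) :
    |f (θ + s • v, I) - f (θ, I) - s * fderiv ℝ f (θ, I) (v, 0)| ≤
      (∑ i, |v i|) * (2 * n) * ‖v‖ * s ^ 2 := by
  refine abs_sub_sub_le_of_lipschitz_deriv (F := fun θ => f (θ, I))
    (G := fun θ => fderiv ℝ f (θ, I) (v, 0)) (by positivity) (fun θ => ?_)
    (isTorusLipschitz_fderiv_section hf hper hf1 hI v).lipschitz θ s
  have := (differentiableAt_of_mem_phaseSpace hf
    (mem_phaseSpace.2 hI : (θ, I) ∈ phaseSpace n)).hasFDerivAt.hasLineDerivAt (v, 0)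
  simpa [HasLineDerivAt] using this

end Perturbation

end MicroDiffusion

/-! ### Existence of solutions of the Hamiltonian system -/

namespace MicroDiffusion

/-- Global existence for a bounded Lipschitz vector field. -/
theorem exists_curve_of_lipschitz_bounded {E : Type*} [NormedAddCommGroup E] [NormedSpace ℝ E]
    [CompleteSpace E] {V : E → E} {M L : NNReal} (hV : LipschitzWith M V) (hL : ∀ x, ‖V x‖ ≤ L)
    (x₀ : E) {τ : ℝ} (hτ : 0 ≤ τ) :
    ∃ γ : ℝ → E, γ 0 = x₀ ∧ ∀ t ∈ Icc 0 τ, HasDerivWithinAt γ (V (γ t)) (Icc 0 τ) t := by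
  have h : IsPicardLindelof (fun _ => V) (⟨0, left_mem_Icc.2 hτ⟩ : Icc 0 τ) x₀
      (L * ⟨τ, hτ⟩) 0 L M :=
    IsPicardLindelof.of_time_independent (fun x _ => hL x) hV.lipschitzOnWith (by
      have : ((L * ⟨τ, hτ⟩ : NNReal) : ℝ) = L * τ := rfl
      simp [hτ, this])
  exact h.exists_eq_forall_mem_Icc_hasDerivWithinAt₀

variable {n : ℕ}

/-- The retraction of `ℝⁿ` onto a closed ball of the supremum norm, coordinate by coordinate. -/
noncomputable def clampBall (I₀ : Fin n → ℝ) {r : ℝ} (hr : 0 ≤ r) (I : Fin n → ℝ) : Fin n → ℝ :=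
  fun i => projIcc (I₀ i - r) (I₀ i + r) (by linarith) (I i)

theorem clampBall_mem (I₀ : Fin n → ℝ) {r : ℝ} (hr : 0 ≤ r) (I : Fin n → ℝ) :
    clampBall I₀ hr I ∈ Metric.closedBall I₀ r := by
  rw [mem_closedBall_iff_norm, pi_norm_le_iff_of_nonneg hr]
  intro i
  have := (projIcc (I₀ i - r) (I₀ i + r) (by linarith) (I i)).2
  rw [Pi.sub_apply, Real.norm_eq_abs, abs_le]
  simp only [clampBall]
  constructor <;> linarith [this.1, this.2]

theorem norm_clampBall_sub_le (I₀ : Fin n → ℝ) {r : ℝ} (hr : 0 ≤ r) (I J : Fin n → ℝ) :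
    ‖clampBall I₀ hr I - clampBall I₀ hr J‖ ≤ ‖I - J‖ :=
  (pi_norm_le_iff_of_nonneg (norm_nonneg _)).2 fun i =>
    (abs_projIcc_sub_projIcc (by linarith)).trans (norm_le_pi_norm (I - J) i)

theorem clampBall_eq (I₀ : Fin n → ℝ) {r : ℝ} (hr : 0 ≤ r) {I : Fin n → ℝ}
    (hI : I ∈ Metric.closedBall I₀ r) : clampBall I₀ hr I = I := by
  rw [mem_closedBall_iff_norm, pi_norm_le_iff_of_nonneg hr] at hI
  ext i
  have := abs_le.1 (hI i)
  rw [Pi.sub_apply] at this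
  simp only [clampBall]
  rw [projIcc_of_mem]
  constructor <;> linarith [this.1, this.2]

/-- The partial derivatives of `f` with respect to the angles. -/
noncomputable def angleGrad (f : (Fin n → ℝ) × (Fin n → ℝ) → ℝ) (p : (Fin n → ℝ) × (Fin n → ℝ)) :
    Fin n → ℝ := fun i => fderiv ℝ f p (stdVecProd n (Sum.inl i))

/-- The partial derivatives of `f` with respect to the actions. -/
noncomputable def actionGrad (f : (Fin n → ℝ) × (Fin n → ℝ) → ℝ)
    (p : (Fin n → ℝ) × (Fin n → ℝ)) : Fin n → ℝ := fun i => fderiv ℝ f p (stdVecProd n (Sum.inr i))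

/-- The Hamiltonian vector field of `h(I) + ε f(θ, I)`. -/
noncomputable def hamiltonianField (h : (Fin n → ℝ) → ℝ) (f : (Fin n → ℝ) × (Fin n → ℝ) → ℝ)
    (ε : ℝ) (p : (Fin n → ℝ) × (Fin n → ℝ)) : (Fin n → ℝ) × (Fin n → ℝ) :=
  (grad h p.2 + ε • actionGrad f p, -(ε • angleGrad f p))

variable {h : (Fin n → ℝ) → ℝ} {f : (Fin n → ℝ) × (Fin n → ℝ) → ℝ} {ε : ℝ}

theorem norm_angleGrad_le (hf1 : cNorm (stdVecProd n) 3 (phaseSpace n) f ≤ 1)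
    {p : (Fin n → ℝ) × (Fin n → ℝ)} (hp : p ∈ phaseSpace n) : ‖angleGrad f p‖ ≤ 1 :=
  (pi_norm_le_iff_of_nonneg zero_le_one).2 fun _ => abs_fderiv_basis_le_one (by norm_num) hf1 hp _

theorem norm_actionGrad_le (hf1 : cNorm (stdVecProd n) 3 (phaseSpace n) f ≤ 1)
    {p : (Fin n → ℝ) × (Fin n → ℝ)} (hp : p ∈ phaseSpace n) : ‖actionGrad f p‖ ≤ 1 :=
  (pi_norm_le_iff_of_nonneg zero_le_one).2 fun _ => abs_fderiv_basis_le_one (by norm_num) hf1 hp _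

theorem norm_angleGrad_sub_le (hf : ContDiffOn ℝ 3 f (phaseSpace n))
    (hf1 : cNorm (stdVecProd n) 3 (phaseSpace n) f ≤ 1)
    {p q : (Fin n → ℝ) × (Fin n → ℝ)} (hp : p ∈ phaseSpace n) (hq : q ∈ phaseSpace n) :
    ‖angleGrad f p - angleGrad f q‖ ≤ 2 * n * ‖p - q‖ :=
  (pi_norm_le_iff_of_nonneg (by positivity)).2 fun _ => abs_fderiv_prod_sub_le hf hf1 _ hp hq

theorem norm_actionGrad_sub_le (hf : ContDiffOn ℝ 3 f (phaseSpace n))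
    (hf1 : cNorm (stdVecProd n) 3 (phaseSpace n) f ≤ 1)
    {p q : (Fin n → ℝ) × (Fin n → ℝ)} (hp : p ∈ phaseSpace n) (hq : q ∈ phaseSpace n) :
    ‖actionGrad f p - actionGrad f q‖ ≤ 2 * n * ‖p - q‖ :=
  (pi_norm_le_iff_of_nonneg (by positivity)).2 fun _ => abs_fderiv_prod_sub_le hf hf1 _ hp hq

theorem norm_hamiltonianField_sub_le (hh : ContDiffOn ℝ 3 h (actionBall n))
    (hh1 : cNorm (stdVec n) 2 (actionBall n) h ≤ 1) (hf : ContDiffOn ℝ 3 f (phaseSpace n))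
    (hf1 : cNorm (stdVecProd n) 3 (phaseSpace n) f ≤ 1) (hε : 0 ≤ ε)
    {p q : (Fin n → ℝ) × (Fin n → ℝ)} (hp : p ∈ phaseSpace n) (hq : q ∈ phaseSpace n) :
    ‖hamiltonianField h f ε p - hamiltonianField h f ε q‖ ≤ (n + ε * (2 * n)) * ‖p - q‖ := by
  rw [norm_prod_le_iff]
  constructor
  · have e : (hamiltonianField h f ε p - hamiltonianField h f ε q).1 =
        (grad h p.2 - grad h q.2) + ε • (actionGrad f p - actionGrad f q) := by
      simp only [hamiltonianField, Prod.fst_sub, smul_sub]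
      abel
    rw [e]
    have h1 := abs_grad_sub_le hh hh1 (mem_phaseSpace.1 hp) (mem_phaseSpace.1 hq)
    have h2 := norm_actionGrad_sub_le hf hf1 hp hq
    have h3 : ‖p.2 - q.2‖ ≤ ‖p - q‖ := norm_snd_le (p - q)
    calc _ ≤ ‖grad h p.2 - grad h q.2‖ + ε * ‖actionGrad f p - actionGrad f q‖ := by
          refine (norm_add_le _ _).trans_eq ?_
          rw [norm_smul, Real.norm_eq_abs, abs_of_nonneg hε]
      _ ≤ n * ‖p - q‖ + ε * (2 * n * ‖p - q‖) := by
          refine add_le_add (h1.trans ?_) ?_ <;> gcongr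
      _ = _ := by ring
  · have e : (hamiltonianField h f ε p - hamiltonianField h f ε q).2 =
        -(ε • (angleGrad f p - angleGrad f q)) := by
      simp only [hamiltonianField, Prod.snd_sub, smul_sub]
      abel
    rw [e, norm_neg, norm_smul, Real.norm_eq_abs, abs_of_nonneg hε]
    have h2 := norm_angleGrad_sub_le hf hf1 hp hq
    calc _ ≤ ε * (2 * n * ‖p - q‖) := by gcongr
      _ ≤ n * ‖p - q‖ + ε * (2 * n * ‖p - q‖) := le_add_of_nonneg_left (by positivity)
      _ = _ := by ring

theorem grad_hamiltonian_action (hh : ContDiffOn ℝ 3 h (actionBall n))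
    (hf : ContDiffOn ℝ 3 f (phaseSpace n)) {θ I : Fin n → ℝ} (hI : I ∈ actionBall n) :
    grad (fun J => hamiltonian h f ε (θ, J)) I = (hamiltonianField h f ε (θ, I)).1 := by
  have h1 : HasFDerivAt h (fderiv ℝ h I) I :=
    ((hh.differentiableOn (by norm_num)).differentiableAt
      (isOpen_actionBall.mem_nhds hI)).hasFDerivAt
  have h2 := (differentiableAt_of_mem_phaseSpace hf
    (mem_phaseSpace.2 hI : (θ, I) ∈ phaseSpace n)).hasFDerivAt.comp I (hasFDerivAt_prodMk_right θ I)
  have h3 : HasFDerivAt (fun J => hamiltonian h f ε (θ, J)) _ I := h1.add (h2.const_smul ε)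
  ext i
  rw [grad, h3.fderiv]
  simp [hamiltonianField, grad, actionGrad, stdVecProd]

theorem grad_hamiltonian_angle (hf : ContDiffOn ℝ 3 f (phaseSpace n)) {θ I : Fin n → ℝ}
    (hI : I ∈ actionBall n) :
    -grad (fun φ => hamiltonian h f ε (φ, I)) θ = (hamiltonianField h f ε (θ, I)).2 := by
  have h2 := HasFDerivAt.comp (f := fun φ : Fin n → ℝ => (φ, I)) θ
    (differentiableAt_of_mem_phaseSpace hf
      (mem_phaseSpace.2 hI : (θ, I) ∈ phaseSpace n)).hasFDerivAt (hasFDerivAt_prodMk_left θ I)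
  have h3 : HasFDerivAt (fun φ => hamiltonian h f ε (φ, I)) _ θ :=
    (h2.const_smul ε).const_add (h I)
  ext i
  rw [Pi.neg_apply, grad, h3.fderiv]
  simp [hamiltonianField, angleGrad, stdVecProd]

/-- Solutions of the Hamiltonian system exist as long as the a priori bound `ε t` on the variation
of the actions keeps them inside the domain. -/
theorem exists_solution (hh : ContDiffOn ℝ 3 h (actionBall n))
    (hh1 : cNorm (stdVec n) 2 (actionBall n) h ≤ 1) (hf : ContDiffOn ℝ 3 f (phaseSpace n))
    (hf1 : cNorm (stdVecProd n) 3 (phaseSpace n) f ≤ 1) (hε : 0 ≤ ε) (θ₀ I₀ : Fin n → ℝ) {τ : ℝ}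
    (hτ : 0 ≤ τ) (hball : ε * τ < 1 - ‖I₀‖) :
    ∃ θ I : ℝ → (Fin n → ℝ), θ 0 = θ₀ ∧ I 0 = I₀ ∧ IsSolution (hamiltonian h f ε) τ θ I ∧
      ∀ t ∈ Icc 0 τ, I t ∈ actionBall n ∧ ‖I t - I₀‖ ≤ ε * t ∧
        HasDerivWithinAt θ (hamiltonianField h f ε (θ t, I t)).1 (Icc 0 τ) t ∧
        HasDerivWithinAt I (hamiltonianField h f ε (θ t, I t)).2 (Icc 0 τ) t := by
  have hr : 0 ≤ ε * τ := mul_nonneg hε hτ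
  have hsub : Metric.closedBall I₀ (ε * τ) ⊆ actionBall n := fun J hJ => by
    rw [mem_closedBall_iff_norm] at hJ
    rw [actionBall, mem_ball_zero_iff]
    calc ‖J‖ = ‖J - I₀ + I₀‖ := by rw [sub_add_cancel]
      _ ≤ ‖J - I₀‖ + ‖I₀‖ := norm_add_le _ _
      _ < 1 := by linarith
  let cl : (Fin n → ℝ) × (Fin n → ℝ) → (Fin n → ℝ) × (Fin n → ℝ) :=
    fun p => (p.1, clampBall I₀ hr p.2)
  have hcl : ∀ p, cl p ∈ phaseSpace n := fun p => mem_phaseSpace.2 (hsub (clampBall_mem I₀ hr p.2))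
  have hclL : ∀ p q, ‖cl p - cl q‖ ≤ ‖p - q‖ := fun p q => by
    rw [norm_prod_le_iff]
    exact ⟨norm_fst_le (p - q), (norm_clampBall_sub_le I₀ hr p.2 q.2).trans (norm_snd_le (p - q))⟩
  have hM : 0 ≤ n + ε * (2 * n) := by positivity
  have hV : LipschitzWith ⟨_, hM⟩ (fun p => hamiltonianField h f ε (cl p)) :=
    LipschitzWith.of_dist_le_mul fun p q => by
      rw [dist_eq_norm, dist_eq_norm]
      exact (norm_hamiltonianField_sub_le hh hh1 hf hf1 hε (hcl p) (hcl q)).trans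
        (mul_le_mul_of_nonneg_left (hclL p q) hM)
  have hV2 : ∀ p, ‖(hamiltonianField h f ε (cl p)).2‖ ≤ ε := fun p => by
    simp only [hamiltonianField]
    rw [norm_neg, norm_smul, Real.norm_eq_abs, abs_of_nonneg hε]
    exact mul_le_of_le_one_right hε (norm_angleGrad_le hf1 (hcl p))
  have hV1 : ∀ p, ‖(hamiltonianField h f ε (cl p)).1‖ ≤ 1 + ε := fun p => by
    simp only [hamiltonianField]
    refine (norm_add_le _ _).trans (add_le_add (norm_grad_le hh1 (mem_phaseSpace.1 (hcl p))) ?_)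
    rw [norm_smul, Real.norm_eq_abs, abs_of_nonneg hε]
    exact mul_le_of_le_one_right hε (norm_actionGrad_le hf1 (hcl p))
  have hL : (0 : ℝ) ≤ 1 + ε := by positivity
  obtain ⟨γ, hγ0, hγ⟩ := exists_curve_of_lipschitz_bounded (L := ⟨1 + ε, hL⟩) hV
    (fun p => norm_prod_le_iff.2 ⟨hV1 p, (hV2 p).trans (by change ε ≤ 1 + ε; linarith)⟩)
    (θ₀, I₀) hτ
  have hfst : ∀ t ∈ Icc 0 τ, HasDerivWithinAt (fun t => (γ t).1)
      (hamiltonianField h f ε (cl (γ t))).1 (Icc 0 τ) t := fun t ht =>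
    (ContinuousLinearMap.fst ℝ (Fin n → ℝ) (Fin n → ℝ)).hasFDerivAt.comp_hasDerivWithinAt t (hγ t ht)
  have hsnd : ∀ t ∈ Icc 0 τ, HasDerivWithinAt (fun t => (γ t).2)
      (hamiltonianField h f ε (cl (γ t))).2 (Icc 0 τ) t := fun t ht =>
    (ContinuousLinearMap.snd ℝ (Fin n → ℝ) (Fin n → ℝ)).hasFDerivAt.comp_hasDerivWithinAt t (hγ t ht)
  have hdist : ∀ t ∈ Icc 0 τ, ‖(γ t).2 - I₀‖ ≤ ε * t := by
    intro t ht
    have := (convex_Icc 0 τ).norm_image_sub_le_of_norm_hasDerivWithin_le hsnd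
      (fun t _ => hV2 (γ t)) (left_mem_Icc.2 hτ) ht
    rwa [hγ0, sub_zero, Real.norm_eq_abs, abs_of_nonneg ht.1] at this
  have hmem : ∀ t ∈ Icc 0 τ, (γ t).2 ∈ Metric.closedBall I₀ (ε * τ) := fun t ht => by
    rw [mem_closedBall_iff_norm]
    exact (hdist t ht).trans (mul_le_mul_of_nonneg_left ht.2 hε)
  have hcleq : ∀ t ∈ Icc 0 τ, cl (γ t) = ((γ t).1, (γ t).2) := fun t ht => by
    simp only [cl, clampBall_eq I₀ hr (hmem t ht)]
  have hall : ∀ t ∈ Icc 0 τ, (γ t).2 ∈ actionBall n ∧ ‖(γ t).2 - I₀‖ ≤ ε * t ∧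
      HasDerivWithinAt (fun t => (γ t).1) (hamiltonianField h f ε ((γ t).1, (γ t).2)).1
        (Icc 0 τ) t ∧
      HasDerivWithinAt (fun t => (γ t).2) (hamiltonianField h f ε ((γ t).1, (γ t).2)).2
        (Icc 0 τ) t := fun t ht =>
    ⟨hsub (hmem t ht), hdist t ht, hcleq t ht ▸ hfst t ht, hcleq t ht ▸ hsnd t ht⟩
  refine ⟨fun t => (γ t).1, fun t => (γ t).2, by simp only [hγ0], by simp only [hγ0],
    fun t ht => ?_, hall⟩
  obtain ⟨h1, -, h3, h4⟩ := hall t ht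
  refine ⟨h1, ?_, ?_⟩
  · rw [grad_hamiltonian_action hh hf h1]
    exact h3
  · rw [grad_hamiltonian_angle hf h1]
    exact h4

end MicroDiffusion

/-! ### Drift along the resonant subspace and confinement transverse to it -/

namespace MicroDiffusion

variable {n : ℕ} {h : (Fin n → ℝ) → ℝ} {f : (Fin n → ℝ) × (Fin n → ℝ) → ℝ}

theorem sum_abs_single (i : Fin n) : ∑ j, |(Pi.single i 1 : Fin n → ℝ) j| = 1 := by
  rw [Finset.sum_eq_single i]
  · simp
  · intro j _ hj
    simp [hj]
  · simp

theorem dotProduct_angleGrad (v : Fin n → ℝ) (p : (Fin n → ℝ) × (Fin n → ℝ)) :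
    v ⬝ᵥ angleGrad f p = fderiv ℝ f p (v, 0) := by
  rw [fderiv_prod_left_eq_sum]
  rfl

/-- The orbit issued from `(θ₀, I₀)` over the time `δ / r`, where `r = √ε`: the actions move by at
most `δ r`, the angles follow the linear flow of frequency `∂h(I₀)` up to a drift `ζ` of speed
`(n + 1) δ r`, and the actions frozen at `I₀` give the correct variation of the actions to first
order. -/
theorem exists_trajectory (hh : ContDiffOn ℝ 3 h (actionBall n))
    (hh1 : cNorm (stdVec n) 2 (actionBall n) h ≤ 1) (hf : ContDiffOn ℝ 3 f (phaseSpace n))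
    (hper : AnglePeriodic f) (hf1 : cNorm (stdVecProd n) 3 (phaseSpace n) f ≤ 1)
    (θ₀ : Fin n → ℝ) {I₀ : Fin n → ℝ} (hI₀ : I₀ ∈ actionBall n) {r δ : ℝ} (hr : 0 < r)
    (hδ : 0 < δ) (hrδ : r ≤ δ) (hball : δ * r < 1 - ‖I₀‖) :
    ∃ (θ I ζ : ℝ → (Fin n → ℝ)), IsSolution (hamiltonian h f (r ^ 2)) (δ / r) θ I ∧ I 0 = I₀ ∧
      ζ 0 = θ₀ ∧ (∀ s u, ‖ζ s - ζ u‖ ≤ (n + 1) * δ * r * |s - u|) ∧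
      ∀ v : Fin n → ℝ, ∀ t ∈ Icc 0 (δ / r),
        |v ⬝ᵥ (I t - I₀) + r ^ 2 * ∫ s in (0 : ℝ)..t,
          fderiv ℝ f (s • grad h I₀ + ζ s, I₀) (v, 0)| ≤
          r ^ 2 * ((∑ i, |v i|) * (2 * n) * (δ * r)) * t := by
  have hτ : 0 ≤ δ / r := by positivity
  have hετ : r ^ 2 * (δ / r) = δ * r := by field_simp
  obtain ⟨θ, I, hθ0, hI0, hsol, hdyn⟩ := exists_solution hh hh1 hf hf1 (sq_nonneg r) θ₀ I₀ hτ
    (by rwa [hετ])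
  have hIdist : ∀ t ∈ Icc 0 (δ / r), ‖I t - I₀‖ ≤ δ * r := fun t ht =>
    ((hdyn t ht).2.1.trans (mul_le_mul_of_nonneg_left ht.2 (sq_nonneg r))).trans_eq hετ
  set ω := grad h I₀ with hω
  have hslow : ∀ t ∈ Icc 0 (δ / r), HasDerivWithinAt (fun t => θ t - t • ω)
      ((hamiltonianField h f (r ^ 2) (θ t, I t)).1 - ω) (Icc 0 (δ / r)) t := fun t ht => by
    have h1 : HasDerivWithinAt (fun t : ℝ => t • ω) ω (Icc 0 (δ / r)) t := by
      simpa using ((hasDerivAt_id t).smul_const ω).hasDerivWithinAt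
    exact (hdyn t ht).2.2.1.sub h1
  have hspeed : ∀ t ∈ Icc 0 (δ / r),
      ‖(hamiltonianField h f (r ^ 2) (θ t, I t)).1 - ω‖ ≤ (n + 1) * δ * r := by
    intro t ht
    have e : (hamiltonianField h f (r ^ 2) (θ t, I t)).1 - ω =
        (grad h (I t) - grad h I₀) + r ^ 2 • actionGrad f (θ t, I t) := by
      simp only [hamiltonianField, hω]
      abel
    rw [e]
    have h1 := abs_grad_sub_le hh hh1 (hdyn t ht).1 hI₀
    have h2 := norm_actionGrad_le hf1 (mem_phaseSpace.2 (hdyn t ht).1 : (θ t, I t) ∈ phaseSpace n)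
    calc _ ≤ ‖grad h (I t) - grad h I₀‖ + r ^ 2 * ‖actionGrad f (θ t, I t)‖ := by
          refine (norm_add_le _ _).trans_eq ?_
          rw [norm_smul, Real.norm_eq_abs, abs_of_nonneg (sq_nonneg r)]
      _ ≤ n * (δ * r) + r ^ 2 * 1 := by
          refine add_le_add (h1.trans ?_) ?_
          · exact mul_le_mul_of_nonneg_left (hIdist t ht) (Nat.cast_nonneg n)
          · exact mul_le_mul_of_nonneg_left h2 (sq_nonneg r)
      _ ≤ _ := by nlinarith
  let ζ : ℝ → (Fin n → ℝ) := fun s =>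
    θ (projIcc 0 (δ / r) hτ s) - ((projIcc 0 (δ / r) hτ s : Icc 0 (δ / r)) : ℝ) • ω
  have hζ : ∀ s ∈ Icc 0 (δ / r), ζ s = θ s - s • ω := fun s hs => by
    simp only [ζ]
    rw [projIcc_of_mem hτ hs]
  have hζL : ∀ s u, ‖ζ s - ζ u‖ ≤ (n + 1) * δ * r * |s - u| := by
    intro s u
    refine ((convex_Icc 0 (δ / r)).norm_image_sub_le_of_norm_hasDerivWithin_le hslow hspeed
      (projIcc 0 (δ / r) hτ u).2 (projIcc 0 (δ / r) hτ s).2).trans ?_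
    exact mul_le_mul_of_nonneg_left (abs_projIcc_sub_projIcc hτ) (by positivity)
  refine ⟨θ, I, ζ, hsol, hI0, ?_, hζL, ?_⟩
  · rw [hζ 0 (left_mem_Icc.2 hτ), hθ0, zero_smul, sub_zero]
  intro v t ht
  have hζc : Continuous ζ := by
    refine (LipschitzWith.of_dist_le_mul (K := ⟨(n + 1) * δ * r, by positivity⟩)
      fun s u => ?_).continuous
    rw [dist_eq_norm, Real.dist_eq]
    exact hζL s u
  have hGc : Continuous fun s : ℝ => fderiv ℝ f (s • ω + ζ s, I₀) (v, 0) :=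
    (isTorusLipschitz_fderiv_section hf hper hf1 hI₀ v).continuous.comp
      (show Continuous fun s : ℝ => s • ω + ζ s by fun_prop)
  have hderiv : ∀ s ∈ Icc 0 (δ / r), HasDerivWithinAt
      (fun t => v ⬝ᵥ (I t - I₀) + r ^ 2 * ∫ s in (0 : ℝ)..t, fderiv ℝ f (s • ω + ζ s, I₀) (v, 0))
      (r ^ 2 * (fderiv ℝ f (θ s, I₀) (v, 0) - fderiv ℝ f (θ s, I s) (v, 0)))
      (Icc 0 (δ / r)) s := by
    intro s hs
    have h1 := (hGc.integral_hasStrictDerivAt 0 s).hasDerivAt.hasDerivWithinAt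
      (s := Icc 0 (δ / r))
    rw [hζ s hs, add_sub_cancel] at h1
    have h2 : HasDerivWithinAt (fun t => v ⬝ᵥ (I t - I₀))
        (v ⬝ᵥ (hamiltonianField h f (r ^ 2) (θ s, I s)).2) (Icc 0 (δ / r)) s := by
      simp only [dotProduct]
      refine HasDerivWithinAt.fun_sum fun i _ => ?_
      have h3 := (hasDerivWithinAt_pi.1 (hdyn s hs).2.2.2 i)
      exact (h3.sub_const (I₀ i)).const_mul (v i)
    refine (h2.add (h1.const_mul (r ^ 2))).congr_deriv ?_
    simp only [hamiltonianField]
    rw [dotProduct_neg, dotProduct_smul, dotProduct_angleGrad, smul_eq_mul]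
    ring
  have hbound : ∀ s ∈ Icc 0 (δ / r),
      ‖r ^ 2 * (fderiv ℝ f (θ s, I₀) (v, 0) - fderiv ℝ f (θ s, I s) (v, 0))‖ ≤
      r ^ 2 * ((∑ i, |v i|) * (2 * n) * (δ * r)) := by
    intro s hs
    rw [norm_mul, Real.norm_eq_abs, abs_of_nonneg (sq_nonneg r)]
    refine mul_le_mul_of_nonneg_left ?_ (sq_nonneg r)
    refine (abs_fderiv_left_sub_le hf hf1 v (mem_phaseSpace.2 hI₀)
      (mem_phaseSpace.2 (hdyn s hs).1)).trans ?_
    refine mul_le_mul_of_nonneg_left ?_ (by positivity)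
    rw [Prod.norm_def, Prod.fst_sub, Prod.snd_sub, sub_self, norm_zero, norm_sub_rev,
      max_eq_right (norm_nonneg _)]
    exact hIdist s hs
  have := (convex_Icc 0 (δ / r)).norm_image_sub_le_of_norm_hasDerivWithin_le hderiv hbound
    (left_mem_Icc.2 hτ) ht
  simpa [hI0, abs_of_nonneg ht.1] using this

/-- A non-zero partial derivative of the averaged perturbation is approximated by finite time
averages. -/
theorem abs_integral_sub_grad_average_le (K : BandLimitedKernel)
    (hf : ContDiffOn ℝ 3 f (phaseSpace n)) (hper : AnglePeriodic f)
    (hf1 : cNorm (stdVecProd n) 3 (phaseSpace n) f ≤ 1) {I₀ ω θ₀ : Fin n → ℝ}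
    (hI₀ : I₀ ∈ actionBall n) {i : Fin n}
    (hne : grad (fun θ => average ω f θ I₀) θ₀ i ≠ 0) {N T : ℝ} (hN : 0 < N) (hT : 0 < T)
    (hNT : SmallDivisorBound ω N T) {t : ℝ} (ht : 0 ≤ t) :
    |(∫ s in (0 : ℝ)..t, fderiv ℝ f (θ₀ + s • ω, I₀) (Pi.single i 1, 0)) -
        t * grad (fun θ => average ω f θ I₀) θ₀ i| ≤
      K.moment * (T * 2) + 2 * (K.smoothingConst n * (2 * n / N)) * t := by
  have hF := isTorusLipschitz_section hf hper hf1 hI₀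
  have hG := isTorusLipschitz_fderiv_section hf hper hf1 hI₀ (Pi.single i 1)
  rw [sum_abs_single, one_mul] at hG
  have hn : (0 : ℝ) ≤ 2 * n := by positivity
  have hav : ∀ θ, Tendsto (fun t : ℝ => (1 / t) * ∫ s in (0 : ℝ)..t, f (θ + s • ω, I₀)) atTop
      (𝓝 (average ω f θ I₀)) := by
    intro θ
    obtain ⟨A, hA, -⟩ := hF.exists_tendsto_average K hn ω θ
    rw [average, hA.limUnder_eq]
    exact hA
  obtain ⟨A, hA, hAb⟩ := hG.exists_tendsto_average K hn ω θ₀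
  have hd : DifferentiableAt ℝ (fun θ => average ω f θ I₀) θ₀ := by
    by_contra hd
    refine hne ?_
    rw [grad, fderiv_zero_of_not_differentiableAt hd]
    rfl
  have hgrad : grad (fun θ => average ω f θ I₀) θ₀ i = A :=
    fderiv_average_eq hF.continuous hG.continuous
      (fun θ s => abs_section_taylor_le hf hper hf1 hI₀ (Pi.single i 1) θ s) hav hA hd
  rw [hgrad]
  simpa using hAb N T hN hT hNT t ht

/-- The drift of the actions: over the time `δ / r` the averaged force, of size `lam`, dominates all
error terms. -/
theorem drift_lower_bound (K : BandLimitedKernel)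
    (hf : ContDiffOn ℝ 3 f (phaseSpace n)) (hper : AnglePeriodic f)
    (hf1 : cNorm (stdVecProd n) 3 (phaseSpace n) f ≤ 1) {I₀ ω θ₀ : Fin n → ℝ}
    (hI₀ : I₀ ∈ actionBall n) {lam r δ N T : ℝ} (hlam : 0 < lam)
    (hlam' : lam = ‖grad (fun θ => average ω f θ I₀) θ₀‖)
    (hr : 0 < r) (hδ : 0 < δ) (hrδ : r ≤ δ) (hδlam : 2 * n * (n + 2) * δ ^ 2 ≤ lam / 4)
    (hN : 0 < N) (hT : 0 < T) (hNT : SmallDivisorBound ω N T)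
    (hTlam : 2 * K.moment * (r * T) ≤ δ * lam / 8)
    (hNlam : 4 * n * K.smoothingConst n * (1 / N) ≤ lam / 8)
    {J : Fin n → ℝ} {ζ : ℝ → (Fin n → ℝ)} (hζ0 : ζ 0 = θ₀)
    (hζ : ∀ s u, ‖ζ s - ζ u‖ ≤ (n + 1) * δ * r * |s - u|)
    (hJ : ∀ v : Fin n → ℝ, |v ⬝ᵥ J + r ^ 2 * ∫ s in (0 : ℝ)..(δ / r),
          fderiv ℝ f (s • ω + ζ s, I₀) (v, 0)| ≤
          r ^ 2 * ((∑ i, |v i|) * (2 * n) * (δ * r)) * (δ / r)) :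
    δ * lam / 2 * r ≤ ‖J‖ := by
  obtain ⟨i, hi⟩ : ∃ i, lam ≤ |grad (fun θ => average ω f θ I₀) θ₀ i| := by
    by_contra hcon
    push Not at hcon
    exact lt_irrefl lam (hlam'.trans_lt ((pi_norm_lt_iff hlam).2 hcon))
  set A := grad (fun θ => average ω f θ I₀) θ₀ i with hA
  have hne : A ≠ 0 := fun h0 => by
    rw [h0, abs_zero] at hi
    linarith
  set τ := δ / r with hτ
  have hτ0 : 0 < τ := by positivity
  have hrτ : r * τ = δ := by rw [hτ]; field_simp
  have hG := isTorusLipschitz_fderiv_section hf hper hf1 hI₀ (Pi.single i 1)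
  have hJi := hJ (Pi.single i 1)
  rw [sum_abs_single, one_mul] at hG hJi
  rw [single_one_dotProduct] at hJi
  have hζc : Continuous ζ := by
    refine (LipschitzWith.of_dist_le_mul (K := ⟨(n + 1) * δ * r, by positivity⟩)
      fun s u => ?_).continuous
    rw [dist_eq_norm, Real.dist_eq]
    exact hζ s u
  have hGc := hG.continuous
  have hc1 : Continuous fun s : ℝ => fderiv ℝ f (s • ω + ζ s, I₀) (Pi.single i 1, 0) :=
    hGc.comp (show Continuous fun s : ℝ => s • ω + ζ s by fun_prop)
  have hc2 : Continuous fun s : ℝ => fderiv ℝ f (θ₀ + s • ω, I₀) (Pi.single i 1, 0) :=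
    hGc.comp (show Continuous fun s : ℝ => θ₀ + s • ω by fun_prop)
  -- Replace the actual angles by the linear flow issued from `θ₀`.
  have h1 : |(∫ s in (0 : ℝ)..τ, fderiv ℝ f (s • ω + ζ s, I₀) (Pi.single i 1, 0)) -
      ∫ s in (0 : ℝ)..τ, fderiv ℝ f (θ₀ + s • ω, I₀) (Pi.single i 1, 0)| ≤
      2 * n * ((n + 1) * δ ^ 2) * τ := by
    rw [← intervalIntegral.integral_sub (hc1.intervalIntegrable _ _) (hc2.intervalIntegrable _ _)]
    have := intervalIntegral.norm_integral_le_of_norm_le_const (a := 0) (b := τ)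
      (f := fun s => fderiv ℝ f (s • ω + ζ s, I₀) (Pi.single i 1, 0) -
        fderiv ℝ f (θ₀ + s • ω, I₀) (Pi.single i 1, 0)) (C := 2 * n * ((n + 1) * δ ^ 2))
      fun s hs => by
        rw [uIoc_of_le hτ0.le] at hs
        refine (hG.lipschitz _ _).trans ?_
        refine mul_le_mul_of_nonneg_left ?_ (by positivity)
        have e : s • ω + ζ s - (θ₀ + s • ω) = ζ s - ζ 0 := by
          rw [hζ0]
          abel
        rw [e]
        refine (hζ s 0).trans ?_
        rw [sub_zero, abs_of_pos hs.1]
        calc (n + 1) * δ * r * s ≤ (n + 1) * δ * r * τ :=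
              mul_le_mul_of_nonneg_left hs.2 (by positivity)
          _ = (n + 1) * δ * (r * τ) := by ring
          _ = _ := by rw [hrτ]; ring
    rwa [sub_zero, abs_of_pos hτ0, Real.norm_eq_abs] at this
  have h2 := abs_integral_sub_grad_average_le K hf hper hf1 hI₀ hne hN hT hNT hτ0.le
  rw [← hA] at h2
  set X := ∫ s in (0 : ℝ)..τ, fderiv ℝ f (s • ω + ζ s, I₀) (Pi.single i 1, 0)
  set Y := ∫ s in (0 : ℝ)..τ, fderiv ℝ f (θ₀ + s • ω, I₀) (Pi.single i 1, 0)
  have hX : τ * lam / 2 + 2 * n * (δ * r) * τ ≤ |X| := by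
    have e1 : K.moment * (T * 2) ≤ τ * lam / 8 := by
      have : r * (K.moment * (T * 2)) ≤ r * (τ * lam / 8) := by
        calc _ = 2 * K.moment * (r * T) := by ring
          _ ≤ δ * lam / 8 := hTlam
          _ = _ := by rw [← hrτ]; ring
      exact le_of_mul_le_mul_left this hr
    have e2 : 2 * (K.smoothingConst n * (2 * n / N)) * τ ≤ lam / 8 * τ := by
      refine mul_le_mul_of_nonneg_right ?_ hτ0.le
      calc _ = 4 * n * K.smoothingConst n * (1 / N) := by ring
        _ ≤ _ := hNlam
    have e3 : 2 * n * (δ * r) * τ ≤ 2 * n * δ ^ 2 * τ := by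
      refine mul_le_mul_of_nonneg_right (mul_le_mul_of_nonneg_left ?_ (by positivity)) hτ0.le
      nlinarith
    have e4 : 2 * n * δ ^ 2 * τ + 2 * n * ((n + 1) * δ ^ 2) * τ ≤ lam / 4 * τ := by
      calc _ = 2 * n * (n + 2) * δ ^ 2 * τ := by ring
        _ ≤ _ := mul_le_mul_of_nonneg_right hδlam hτ0.le
    have e5 : τ * lam ≤ |τ * A| := by
      rw [abs_mul, abs_of_pos hτ0]
      exact mul_le_mul_of_nonneg_left hi hτ0.le
    have e6 : |τ * A| ≤ |X| + |X - Y| + |Y - τ * A| := by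
      calc |τ * A| = |X - (X - Y) - (Y - τ * A)| := by ring_nf
        _ ≤ |X - (X - Y)| + |Y - τ * A| := abs_sub _ _
        _ ≤ _ := by gcongr; exact abs_sub _ _
    linarith
  have h3 : r ^ 2 * |X| ≤ |J i| + r ^ 2 * (2 * n * (δ * r)) * τ := by
    have : |r ^ 2 * X| ≤ |J i + r ^ 2 * X| + |J i| := by
      calc |r ^ 2 * X| = |(J i + r ^ 2 * X) - J i| := by ring_nf
        _ ≤ _ := abs_sub _ _
    rw [abs_mul, abs_of_nonneg (sq_nonneg r)] at this
    linarith
  calc δ * lam / 2 * r = r ^ 2 * (τ * lam / 2) := by rw [← hrτ]; ring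
    _ ≤ |J i| := by nlinarith [mul_le_mul_of_nonneg_left hX (sq_nonneg r)]
    _ ≤ ‖J‖ := norm_le_pi_norm J i

/-- Transverse directions: the actions hardly move in a direction `v` orthogonal to the resonances,
because the force in that direction is a derivative without resonant part. -/
theorem transverse_upper_bound (K : BandLimitedKernel)
    (hf : ContDiffOn ℝ 3 f (phaseSpace n)) (hper : AnglePeriodic f)
    (hf1 : cNorm (stdVecProd n) 3 (phaseSpace n) f ≤ 1) {I₀ ω : Fin n → ℝ}
    (hI₀ : I₀ ∈ actionBall n) {r δ N T S : ℝ} (hr : 0 < r) (hδ : 0 < δ) (hδ1 : δ ≤ 1)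
    (hN : 0 < N) (hT : 0 < T) (hNT : SmallDivisorBound ω N T)
    {v : Fin n → ℝ} (hv : ∀ k : Fin n → ℤ, intVec k ⬝ᵥ ω = 0 → intVec k ⬝ᵥ v = 0)
    (hS : ∑ i, |v i| ≤ S) {J : Fin n → ℝ} {ζ : ℝ → (Fin n → ℝ)}
    (hζ : ∀ s u, ‖ζ s - ζ u‖ ≤ (n + 1) * δ * r * |s - u|) {t : ℝ} (ht : t ∈ Icc 0 (δ / r))
    (hJ : |v ⬝ᵥ J + r ^ 2 * ∫ s in (0 : ℝ)..t, fderiv ℝ f (s • ω + ζ s, I₀) (v, 0)| ≤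
          r ^ 2 * ((∑ i, |v i|) * (2 * n) * (δ * r)) * t) :
    |v ⬝ᵥ J| ≤ r * S * (2 * n * r + K.moment * (2 + 2 * n * (n + 1)) * (r * T) +
      2 * n * K.smoothingConst n * (1 / N)) := by
  have hS0 : 0 ≤ ∑ i, |v i| := Finset.sum_nonneg fun _ _ => abs_nonneg _
  have hF := isTorusLipschitz_section hf hper hf1 hI₀
  have hG := isTorusLipschitz_fderiv_section hf hper hf1 hI₀ v
  have h1 := hF.abs_integral_deriv_le K hG (by positivity) hN hT hNT hv
    (fun θ s => abs_section_taylor_le hf hper hf1 hI₀ v θ s) hζ ht.1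
  set X := ∫ s in (0 : ℝ)..t, fderiv ℝ f (s • ω + ζ s, I₀) (v, 0)
  set s := ∑ i, |v i| with hs
  have hrt : r * t ≤ 1 := by
    calc r * t ≤ r * (δ / r) := mul_le_mul_of_nonneg_left ht.2 hr.le
      _ = δ := by field_simp
      _ ≤ 1 := hδ1
  have hm := K.moment_nonneg
  have hc := K.smoothingConst_nonneg n
  have h2 : |v ⬝ᵥ J| ≤ |v ⬝ᵥ J + r ^ 2 * X| + r ^ 2 * |X| := by
    calc |v ⬝ᵥ J| = |(v ⬝ᵥ J + r ^ 2 * X) - r ^ 2 * X| := by ring_nf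
      _ ≤ |v ⬝ᵥ J + r ^ 2 * X| + |r ^ 2 * X| := abs_sub _ _
      _ = _ := by rw [abs_mul, abs_of_nonneg (sq_nonneg r)]
  calc |v ⬝ᵥ J| ≤ r ^ 2 * (s * (2 * n) * (δ * r)) * t + r ^ 2 *
        (K.moment * (T * (2 * s + s * (2 * n) * ((n + 1) * δ * r) * t)) +
          K.smoothingConst n * (s * (2 * n) / N) * t) := by
        refine h2.trans (add_le_add hJ (mul_le_mul_of_nonneg_left h1 (sq_nonneg r)))
    _ = r * s * (2 * n * r * (δ * (r * t)) +
        K.moment * (2 + 2 * n * (n + 1) * (δ * (r * t))) * (r * T) +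
        2 * n * K.smoothingConst n * (1 / N) * (r * t)) := by ring
    _ ≤ r * S * (2 * n * r * 1 + K.moment * (2 + 2 * n * (n + 1) * 1) * (r * T) +
        2 * n * K.smoothingConst n * (1 / N) * 1) := by
        have h3 : δ * (r * t) ≤ 1 := mul_le_one₀ hδ1 (mul_nonneg hr.le ht.1) hrt
        have := ht.1
        have hS' : 0 ≤ S := hS0.trans hS
        gcongr
    _ = _ := by ring

end MicroDiffusion

/-! ### Choice of the constants -/

namespace MicroDiffusion

theorem exists_pos_forall_mul_le (a c : ℝ) (ha : 0 < a) :
    ∃ m > 0, ∀ μ, 0 < μ → μ ≤ m → c * μ ≤ a := by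
  refine ⟨a / (|c| + 1), by positivity, fun μ hμ hm => ?_⟩
  rw [le_div_iff₀ (by positivity)] at hm
  nlinarith [le_abs_self c]

/-- The arithmetic input: from the value `μ = Δ(1 / r)⁻¹`, where `r = √ε`, a cut-off `N` at least of
order `1 / μ` and a time scale `T` at most of order `μ / r` for which the small divisors are bounded, and the
bound of `r` itself by a multiple of `μ`. -/
theorem exists_cutoff {n : ℕ} (hn : 2 ≤ n) {ω : Fin n → ℝ}
    (P : IntegralProjection (resonantSubspace ω)) (hω : ω ≠ 0) {r μ : ℝ} (hr : 0 < r)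
    (hμ : 0 < μ) (hμΔ : μ = (Delta ω r⁻¹)⁻¹) (hμS : 2 * P.size * μ ≤ 1) :
    ∃ N T : ℝ, 0 < N ∧ 0 < T ∧ SmallDivisorBound ω N T ∧ 1 / N ≤ 2 * P.size * μ ∧
      r * T ≤ 2 * P.den * μ ∧ r ≤ 2 * n * P.size * ‖ω‖ * μ := by
  have hΔ : Delta ω r⁻¹ = μ⁻¹ := by rw [hμΔ, inv_inv]
  obtain ⟨Q, hQ, hQΨ⟩ := exists_Q_of_Delta_pos (ω := ω) (x := r⁻¹) (by rw [hΔ]; positivity)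
  have hS := P.size_pos
  have hD := P.den_pos
  have hw : 0 < ‖ω‖ := norm_pos_iff.2 hω
  have hn0 : (0 : ℝ) < n := by exact_mod_cast (by omega : 0 < n)
  rw [hΔ] at hQ
  have hQ0 : 0 < Q := lt_trans (by positivity) hQ
  have hQμ : 1 ≤ 2 * μ * Q := by
    calc (1 : ℝ) = 2 * μ * (μ⁻¹ / 2) := by field_simp
      _ ≤ 2 * μ * Q := mul_le_mul_of_nonneg_left hQ.le (by positivity)
  have hSQ : P.size ≤ Q := by
    refine le_of_mul_le_mul_left ?_ (show 0 < 2 * μ by positivity)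
    calc 2 * μ * P.size = 2 * P.size * μ := by ring
      _ ≤ 1 := hμS
      _ ≤ _ := hQμ
  have hΨ := P.inv_le_Psi hω hSQ
  have hΨ0 : 0 < Psi ω Q := lt_of_lt_of_le (by positivity) hΨ
  have hrQΨ : r * (Q * Psi ω Q) ≤ 1 := by
    calc r * (Q * Psi ω Q) ≤ r * r⁻¹ := mul_le_mul_of_nonneg_left hQΨ hr.le
      _ = 1 := mul_inv_cancel₀ hr.ne'
  refine ⟨Q / P.size, P.den * Psi ω Q, by positivity, by positivity, P.smallDivisorBound Q, ?_, ?_,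
    ?_⟩
  · rw [one_div_div, div_le_iff₀ hQ0]
    nlinarith
  · refine le_of_mul_le_mul_right ?_ hQ0
    calc r * (P.den * Psi ω Q) * Q = P.den * (r * (Q * Psi ω Q)) := by ring
      _ ≤ P.den * (2 * μ * Q) := mul_le_mul_of_nonneg_left (hrQΨ.trans hQμ) hD.le
      _ = _ := by ring
  · have h1 : 1 ≤ Psi ω Q * (n * P.size * ‖ω‖) := by
      rwa [inv_le_iff_one_le_mul₀ (by positivity)] at hΨ
    refine le_of_mul_le_mul_right ?_ hQ0
    calc r * Q = r * Q * 1 := (mul_one _).symm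
      _ ≤ r * Q * (Psi ω Q * (n * P.size * ‖ω‖)) := mul_le_mul_of_nonneg_left h1 (by positivity)
      _ = r * (Q * Psi ω Q) * (n * P.size * ‖ω‖) := by ring
      _ ≤ 2 * μ * Q * (n * P.size * ‖ω‖) :=
          mul_le_mul_of_nonneg_right (hrQΨ.trans hQμ) (by positivity)
      _ = _ := by ring

end MicroDiffusion

theorem theorem1 (n : ℕ) (hn : 2 ≤ n) (Λ : Submodule ℝ (Fin n → ℝ)) :
    ∃ (κ C c δ : ℝ → ℝ) (μ₀ : ℝ → ℝ → ℝ → ℝ),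
      (∀ w, 0 < κ w) ∧ (∀ w, 0 < C w) ∧ (∀ l, 0 < c l) ∧ (∀ l, 0 < δ l) ∧
      (∀ w l r, 0 < μ₀ w l r) ∧
      ∀ (h : (Fin n → ℝ) → ℝ) (f : (Fin n → ℝ) × (Fin n → ℝ) → ℝ)
        (Istar ω θstar : Fin n → ℝ) (lam ε μ τ : ℝ),
        ContDiffOn ℝ 3 h (MicroDiffusion.actionBall n) →
        ContDiffOn ℝ 3 f (MicroDiffusion.phaseSpace n) →
        MicroDiffusion.AnglePeriodic f →
        MicroDiffusion.cNorm (MicroDiffusion.stdVec n) 2 (MicroDiffusion.actionBall n) h ≤ 1 →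
        MicroDiffusion.cNorm (MicroDiffusion.stdVecProd n) 3 (MicroDiffusion.phaseSpace n) f ≤ 1 →
        Istar ∈ MicroDiffusion.actionBall n →
        ω = MicroDiffusion.grad h Istar →
        MicroDiffusion.IsResonantNonzero ω →
        Λ = MicroDiffusion.resonantSubspace ω →
        lam = ‖MicroDiffusion.grad (fun θ => MicroDiffusion.average ω f θ Istar) θstar‖ →
        0 < lam →
        0 < ε →
        μ = (MicroDiffusion.Delta ω (κ ‖ω‖ * (√ε)⁻¹))⁻¹ →
        0 < μ →
        μ ≤ μ₀ ‖ω‖ lam (1 - ‖Istar‖) →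
        τ = δ lam / √ε →
        ∃ θ I : ℝ → (Fin n → ℝ),
          MicroDiffusion.IsSolution (MicroDiffusion.hamiltonian h f ε) τ θ I ∧
          c lam * √ε ≤ ‖I τ - I 0‖ ∧
          dist (I 0) Istar ≤ C ‖ω‖ * √ε * μ ∧
          ∀ t ∈ Set.Icc 0 τ,
            Metric.infDist (I t - I 0) (Λ : Set (Fin n → ℝ)) ≤ C ‖ω‖ * √ε * μ := by
  by_cases hΛ : ∃ ω₀, Λ = MicroDiffusion.resonantSubspace ω₀
  swap
  · -- `Λ` is not a resonant subspace: no system satisfies the hypotheses.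
    refine ⟨fun _ => 1, fun _ => 1, fun _ => 1, fun _ => 1, fun _ _ _ => 1, by simp, by simp,
      by simp, by simp, by simp, ?_⟩
    intro h f Istar ω θstar lam ε μ τ _ _ _ _ _ _ _ _ hres
    exact absurd ⟨ω, hres⟩ hΛ
  obtain ⟨K⟩ := MicroDiffusion.nonempty_bandLimitedKernel
  have hP : Nonempty (MicroDiffusion.IntegralProjection Λ) := by
    obtain ⟨ω₀, rfl⟩ := hΛ
    exact MicroDiffusion.nonempty_integralProjection ω₀
  obtain ⟨P⟩ := hP
  have hS := P.size_pos
  have hD := P.den_pos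
  have hm := K.moment_nonneg
  have hc := K.smoothingConst_nonneg n
  -- The linear flow approximates the orbit up to `O(δ²)`, which `δ` makes small against `l`.
  have hδex : ∀ l : ℝ, ∃ δ : ℝ, 0 < δ ∧ δ ≤ 1 ∧ (0 < l → 2 * n * (n + 2) * δ ^ 2 ≤ l / 4) := by
    intro l
    by_cases hl : 0 < l
    · obtain ⟨m, hm0, hm⟩ := MicroDiffusion.exists_pos_forall_mul_le (l / 4) (2 * n * (n + 2))
        (by positivity)
      refine ⟨min 1 m, by positivity, min_le_left _ _, fun _ => ?_⟩
      refine le_trans ?_ (hm (min 1 m) (by positivity) (min_le_right _ _))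
      refine mul_le_mul_of_nonneg_left ?_ (by positivity)
      have h1 : min 1 m ≤ 1 := min_le_left _ _
      have h2 : 0 < min 1 m := by positivity
      nlinarith
    · exact ⟨1, one_pos, le_rfl, fun h => absurd h hl⟩
  choose δ hδ0 hδ1 hδl using hδex
  have hcex : ∀ l : ℝ, ∃ c : ℝ, 0 < c ∧ (0 < l → c = δ l * l / 2) := by
    intro l
    by_cases hl : 0 < l
    · exact ⟨_, by have := hδ0 l; positivity, fun _ => rfl⟩
    · exact ⟨1, one_pos, fun h => absurd h hl⟩
  choose c hc0 hcl using hcex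
  have hμex : ∀ w l ρ : ℝ, ∃ m > 0, 0 < l → 0 < ρ → ∀ μ, 0 < μ → μ ≤ m →
      2 * P.size * μ ≤ 1 ∧ 2 * n * P.size * w * μ ≤ δ l ∧ 2 * n * P.size * w * μ ≤ ρ / 2 ∧
      4 * K.moment * P.den * μ ≤ δ l * l / 8 ∧
      8 * n * K.smoothingConst n * P.size * μ ≤ l / 8 := by
    intro w l ρ
    by_cases hl : 0 < l ∧ 0 < ρ
    · have hδ := hδ0 l
      obtain ⟨hl, hρ⟩ := hl
      obtain ⟨m₁, p₁, h₁⟩ := MicroDiffusion.exists_pos_forall_mul_le 1 (2 * P.size) one_pos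
      obtain ⟨m₂, p₂, h₂⟩ := MicroDiffusion.exists_pos_forall_mul_le (δ l)
        (2 * n * P.size * w) hδ
      obtain ⟨m₃, p₃, h₃⟩ := MicroDiffusion.exists_pos_forall_mul_le (ρ / 2)
        (2 * n * P.size * w) (by positivity)
      obtain ⟨m₄, p₄, h₄⟩ := MicroDiffusion.exists_pos_forall_mul_le (δ l * l / 8)
        (4 * K.moment * P.den) (by positivity)
      obtain ⟨m₅, p₅, h₅⟩ := MicroDiffusion.exists_pos_forall_mul_le (l / 8)
        (8 * n * K.smoothingConst n * P.size) (by positivity)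
      refine ⟨min m₁ (min m₂ (min m₃ (min m₄ m₅))), by positivity, fun _ _ μ hμ hμm => ?_⟩
      simp only [le_min_iff] at hμm
      exact ⟨h₁ μ hμ hμm.1, h₂ μ hμ hμm.2.1, h₃ μ hμ hμm.2.2.1, h₄ μ hμ hμm.2.2.2.1,
        h₅ μ hμ hμm.2.2.2.2⟩
    · exact ⟨1, one_pos, fun h₁ h₂ => absurd ⟨h₁, h₂⟩ hl⟩
  choose μ₀ hμ₀ hμ₀l using hμex
  let C₀ : ℝ → ℝ := fun w => P.size * (2 * n * (2 * n * P.size * |w|) +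
    K.moment * (2 + 2 * n * (n + 1)) * (2 * P.den) +
    2 * n * K.smoothingConst n * (2 * P.size))
  have hC₀ : ∀ w, 0 ≤ C₀ w := fun w => by positivity
  refine ⟨fun _ => 1, fun w => 1 + C₀ w / P.den, c, δ, μ₀, fun _ => one_pos,
    fun w => by have := hC₀ w; positivity, hc0, hδ0, hμ₀, ?_⟩
  intro h f Istar ω θstar lam ε μ τ hh hf hper hh1 hf1 hI hωdef hres hΛω hlamdef hlam hε hμdef hμ
    hμle hτ
  subst hΛω
  have hρ : 0 < 1 - ‖Istar‖ := by
    rw [MicroDiffusion.actionBall, mem_ball_zero_iff] at hI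
    linarith
  obtain ⟨q₁, q₂, q₃, q₄, q₅⟩ := hμ₀l ‖ω‖ lam (1 - ‖Istar‖) hlam hρ μ hμ hμle
  have hr : 0 < √ε := Real.sqrt_pos.2 hε
  have hrε : √ε ^ 2 = ε := Real.sq_sqrt hε.le
  rw [← hrε, hτ]
  rw [Real.sqrt_sq hr.le]
  rw [one_mul] at hμdef
  set r := √ε
  obtain ⟨N, T, hN, hT, hNT, hNμ, hTμ, hrμ⟩ :=
    MicroDiffusion.exists_cutoff hn P hres.1 hr hμ hμdef q₁
  have hδ := hδ0 lam
  have hδr : δ lam * r < 1 - ‖Istar‖ := by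
    calc δ lam * r ≤ 1 * r := mul_le_mul_of_nonneg_right (hδ1 lam) hr.le
      _ < 1 - ‖Istar‖ := by linarith
  have hrδ : r ≤ δ lam := hrμ.trans q₂
  obtain ⟨θ, I, ζ, hsol, hI0, hζ0, hζ, hIζ⟩ := MicroDiffusion.exists_trajectory hh hh1 hf hper hf1
    θstar hI hr hδ hrδ hδr
  rw [← hωdef] at hIζ
  refine ⟨θ, I, hsol, ?_, ?_, ?_⟩
  · rw [hcl lam hlam, hI0]
    refine MicroDiffusion.drift_lower_bound K hf hper hf1 hI hlam hlamdef hr hδ hrδ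
      (hδl lam hlam) hN hT hNT ?_ ?_ hζ0 hζ
      fun v => hIζ v _ (Set.right_mem_Icc.2 (by positivity))
    · calc 2 * K.moment * (r * T) ≤ 2 * K.moment * (2 * P.den * μ) := by gcongr
        _ = 4 * K.moment * P.den * μ := by ring
        _ ≤ _ := q₄
    · calc 4 * n * K.smoothingConst n * (1 / N) ≤
            4 * n * K.smoothingConst n * (2 * P.size * μ) := by gcongr
        _ = 8 * n * K.smoothingConst n * P.size * μ := by ring
        _ ≤ _ := q₅
  · rw [hI0, dist_self]
    have := hC₀ ‖ω‖
    positivity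
  · intro t ht
    rw [hI0]
    have hC := hC₀ ‖ω‖
    refine (P.infDist_le _ (r := C₀ ‖ω‖ / P.den * r * μ) (by positivity) fun i => ?_).trans ?_
    · have h1 := MicroDiffusion.transverse_upper_bound K hf hper hf1 hI hr hδ (hδ1 lam) hN hT hNT
        (v := MicroDiffusion.intVec (P.vec i))
        (fun k hk => by
          rw [dotProduct_comm]
          exact P.orthogonal i _ (Submodule.subset_span ⟨k, hk, rfl⟩))
        (P.sum_abs_le_size i) hζ ht (hIζ _ t ht)
      refine h1.trans ?_
      calc _ ≤ r * P.size * (2 * n * (2 * n * P.size * ‖ω‖ * μ) +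
            K.moment * (2 + 2 * n * (n + 1)) * (2 * P.den * μ) +
            2 * n * K.smoothingConst n * (2 * P.size * μ)) := by gcongr
        _ = C₀ ‖ω‖ * r * μ := by
            simp only [C₀, abs_of_nonneg (norm_nonneg ω)]
            ring
        _ = P.den * (C₀ ‖ω‖ / P.den * r * μ) := by field_simp
    · have : 0 ≤ r * μ := by positivity
      nlinarith
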